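/- Let $G$ be a finitely generated group. All trees are simplicial trees, with edges of length $1$, on which $G$ acts by automorphisms without inversion (no element exchanges the endpoints of an edge), minimally (there is no proper $G$-invariant subtree), and without redundant vertex (every vertex of valence $2$ is the unique fixed point of some element of $G$). A tree may be a point; it is then called trivial. An element or a subgroup of $G$ is elliptic in a tree if it fixes a point of it; an element that is not elliptic is hyperbolic, and then has an axis, the unique line on which it acts as a non-trivial translation. A group is slender if it and all its subgroups are finitely generated, and a tree is slender if all its edge stabilizers are slender. A tree $S$ is elliptic with respect to a tree $T$ if every edge stabilizer of $S$ is elliptic in $T$. A segment is the geodesic joining two vertices, and its translates are its images under elements of $G$. Theorem. Let $S$ be a tree with an action of $G$ as above. Assume that $S$ is locally finite or slender. There exists a finite set $\mathcal I$ of segments of $S$ of length at most $4$ with the following property: if $h\in G$ is hyperbolic in $S$ and its axis contains a translate of each segment $I\in\mathcal I$, then $h$ is hyperbolic in every non-trivial slender tree $T$ such that $S$ is elliptic with respect to $T$. -/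

import Mathlib

open scoped Pointwise

universe u v w

namespace BassSerre

/-- A group is slender if it and all its subgroups are finitely generated. -/
def IsSlender (G : Type*) [Group G] : Prop :=
  ∀ H : Subgroup G, H.FG

/-- `T` is a simplicial tree with vertex set `V`, and `G` acts on it by automorphisms, minimally,
without inversion and without redundant vertex. The trivial tree (a point) is allowed. -/
structure IsGTree (G : Type*) [Group G] {V : Type*} [MulAction G V] (T : SimpleGraph V) :
    Prop where
  isTree : T.IsTree
  smul_adj : ∀ (g : G) (u v : V), T.Adj u v → T.Adj (g • u) (g • v)
  /-- No element exchanges the endpoints of an edge. -/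
  no_inversion : ∀ (g : G) (u v : V), T.Adj u v → ¬ (g • u = v ∧ g • v = u)
  /-- There is no proper invariant subtree. (A subtree is given by its vertex set, which is
  non-empty and induces a connected subgraph.) -/
  minimal : ∀ A : Set V, (T.induce A).Connected → (∀ (g : G), ∀ v ∈ A, g • v ∈ A) → A = Set.univ
  /-- A vertex of valence 2 is the unique fixed point of some element. -/
  no_redundant : ∀ v : V, (T.neighborSet v).ncard = 2 → ∃ g : G, ∀ w : V, g • w = w ↔ w = v

/-- The subgroup `H` of `G` is elliptic in the tree with vertex set `V`: it fixes a point. As there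
are no inversions, fixing a point of the tree amounts to fixing a vertex. -/
def IsEllipticSubgroup {G : Type*} [Group G] (H : Subgroup G) (V : Type*) [MulAction G V] : Prop :=
  ∃ v : V, ∀ g ∈ H, g • v = v

/-- The element `h` of `G` is elliptic in the tree with vertex set `V`: it fixes a point. -/
def IsElliptic {G : Type*} [Group G] (h : G) (V : Type*) [MulAction G V] : Prop :=
  ∃ v : V, h • v = v

/-- The element `h` of `G` is hyperbolic in the tree with vertex set `V`: it is not elliptic. -/
def IsHyperbolic {G : Type*} [Group G] (h : G) (V : Type*) [MulAction G V] : Prop :=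
  ¬ IsElliptic h V

/-- The stabilizer of the edge `uv`. As there are no inversions, it fixes both endpoints. -/
def edgeStabilizer (G : Type*) [Group G] {V : Type*} [MulAction G V] (u v : V) : Subgroup G :=
  MulAction.stabilizer G u ⊓ MulAction.stabilizer G v

/-- Every vertex of `T` has finite valence. -/
def IsLocallyFinite {V : Type*} (T : SimpleGraph V) : Prop :=
  ∀ v : V, (T.neighborSet v).Finite

/-- All edge stabilizers of `T` are slender. -/
def IsSlenderTree (G : Type*) [Group G] {V : Type*} [MulAction G V] (T : SimpleGraph V) : Prop :=
  ∀ u v : V, T.Adj u v → IsSlender (edgeStabilizer G u v)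

/-- The tree `S` is elliptic with respect to the tree with vertex set `W`: every edge stabilizer
of `S` is elliptic in that tree. -/
def IsEllipticWithRespectTo (G : Type*) [Group G] {V : Type*} [MulAction G V] (S : SimpleGraph V)
    (W : Type*) [MulAction G W] : Prop :=
  ∀ u v : V, S.Adj u v → IsEllipticSubgroup (edgeStabilizer G u v) W

/-- The segment joining two vertices of a tree, given by its vertices. -/
def segment {V : Type*} (T : SimpleGraph V) (u v : V) : Set V :=
  {w | T.dist u w + T.dist w v = T.dist u v}

/-- The axis of `h` in the tree `T`, given by its vertices: the line (bi-infinite injective edge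
path) on which `h` acts as a non-trivial translation. For `h` hyperbolic in a tree there is exactly
one such line; the set is empty if `h` is elliptic. -/
def axis {G : Type*} [Group G] {V : Type*} [MulAction G V] (T : SimpleGraph V) (h : G) : Set V :=
  {v | ∃ f : ℤ → V, Function.Injective f ∧ (∀ n, T.Adj (f n) (f (n + 1))) ∧
    (∃ k : ℤ, k ≠ 0 ∧ ∀ n, h • f n = f (n + k)) ∧ v ∈ Set.range f}

end BassSerre

namespace BassSerre

/-! ### Metric geometry of simplicial trees -/

section Tree

variable {V : Type*} {T : SimpleGraph V}

/-! Suppose `h` fixes a vertex `p₀` of `T`. Fix an edge `pq` of `T` with stabilizer `A`. Since `S`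
is elliptic with respect to `T`, there is an equivariant map `f` from oriented edges of `S` to
vertices of `T` (`exists_equivariant`); colour an edge of `S` by the side of `pq` on which its image
lies. The group `A` is slender, so it preserves a core `K` in `S`, a vertex or a line
(`exists_core`: otherwise ping-pong yields a free subgroup of infinite rank). Colours change only at
vertices forming finitely many `A`-orbits, hence within bounded distance of `K`
(`exists_bound_bad`).

A conjugate `t` of `h` also fixes a vertex of `T`. If its axis in `S` leaves `K`, no non-trivial
power of `t` lies in `A`, so far along either end of the axis there are edges whose colour is the
side of the fixed vertex (`exists_large_power`). Thus two branches off `K` crossed outwards by one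
such axis have the same colour, once each branch is known to be monochrome far out
(`hasColour_of_line`).

The test segments are chosen to make this comparison everywhere. Those of length at most 2 join
neighbours of a vertex and connect its link even after two neighbours are removed: the parent of the
vertex, or its two neighbours on the line `K`. In the slender case this robustness is
`KConnected.of_zero`. The others pass through two consecutive branch vertices, at distance at most
2, with one more edge at each end, whence the bound 4. Backward induction on the distance to `K`
shows that every branch is monochrome (`isMonochrome_of_pos`), and moving along `K` shows that all
branches have one colour. But minimality of `T` moves the `f`-image of a large tripod of `S` into
either side of `pq`, and each translate of the tripod has a leg pointing away from `K`: both colours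
occur far out, a contradiction (`IsGTree.not_elliptic_of_test`).

The comparison along `K` needs branch vertices. Since there are no redundant vertices, two adjacent
vertices of valence 2 force `S` to be a line, and then no test segment is needed
(`IsGTree.not_elliptic_of_line`). -/

theorem exists_next (hT : T.IsTree) {u w : V} (h : u ≠ w) :
    ∃ v, T.Adj u v ∧ T.dist v w + 1 = T.dist u w := by
  obtain ⟨p, hp⟩ := hT.1.exists_walk_length_eq_dist u w
  cases p with
  | nil => exact absurd rfl h
  | @cons _ v _ hadj q =>
    refine ⟨v, hadj, ?_⟩
    have h1 := SimpleGraph.dist_le q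
    have h2 := hT.1.dist_triangle (u := u) (v := v) (w := w)
    have h3 := SimpleGraph.dist_eq_one_iff_adj.2 hadj
    simp only [SimpleGraph.Walk.length_cons] at hp
    omega

theorem next_unique (hT : T.IsTree) {u v v' w : V} (h : T.Adj u v) (h' : T.Adj u v')
    (hd : T.dist v w + 1 = T.dist u w) (hd' : T.dist v' w + 1 = T.dist u w) : v = v' := by
  obtain ⟨p, hp⟩ := hT.1.exists_walk_length_eq_dist v w
  obtain ⟨q, hq⟩ := hT.1.exists_walk_length_eq_dist v' w
  have e1 : (SimpleGraph.Walk.cons h p).IsPath :=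
    SimpleGraph.Walk.isPath_of_length_eq_dist _ (by simp [hp, hd])
  have e2 : (SimpleGraph.Walk.cons h' q).IsPath :=
    SimpleGraph.Walk.isPath_of_length_eq_dist _ (by simp [hq, hd'])
  have e := congrArg Subtype.val ((hT.2.subsingleton_path _ _).elim ⟨_, e1⟩ ⟨_, e2⟩)
  simp only [SimpleGraph.Walk.cons.injEq] at e
  exact e.1

theorem dist_adj_cases (hT : T.IsTree) {u v : V} (w : V) (h : T.Adj u v) :
    T.dist v w + 1 = T.dist u w ∨ T.dist v w = T.dist u w + 1 := by
  have h1 := hT.dist_eq_dist_add_one_of_adj w h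
  rw [T.dist_comm (u := w), T.dist_comm (u := w)] at h1
  omega

/-- A path that does not turn back keeps moving away. -/
theorem dist_of_turn (hT : T.IsTree) {a b c w : V} (hab : T.Adj a b) (hbc : T.Adj b c)
    (hne : c ≠ a) (hd : T.dist b w = T.dist a w + 1) : T.dist c w = T.dist b w + 1 := by
  rcases dist_adj_cases hT w hbc with h | h
  · exact absurd (next_unique hT hbc hab.symm h hd.symm) hne
  · exact h

theorem dist_two (hT : T.IsTree) {a b c : V} (hab : T.Adj a b) (hbc : T.Adj b c)
    (hne : c ≠ a) : T.dist a c = 2 := by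
  have h1 := SimpleGraph.dist_eq_one_iff_adj.2 hab
  rw [T.dist_comm] at h1
  have := dist_of_turn hT hab hbc hne (w := a) (by simp [h1])
  rw [T.dist_comm]; omega

/-- Two geodesics issuing from `m` in different directions form a geodesic. -/
theorem dist_concat (hT : T.IsTree) {y m w : V}
    (h : ∀ v, T.Adj m v → T.dist v y + 1 = T.dist m y → T.dist v w = T.dist m w + 1) :
    T.dist y w = T.dist y m + T.dist m w := by
  induction hn : T.dist m w generalizing m with
  | zero =>
    have := hT.1.dist_eq_zero_iff.1 hn
    subst this; simp
  | succ n ih =>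
    have hne : m ≠ w := by rintro rfl; simp at hn
    obtain ⟨m1, hadj, hd⟩ := exists_next hT hne
    have hy : T.dist m1 y = T.dist m y + 1 := by
      rcases dist_adj_cases hT y hadj with h1 | h1
      · have := h m1 hadj h1; omega
      · exact h1
    have := ih (m := m1) (fun v hv hvy => by
      have : v = m := next_unique hT hv hadj.symm hvy hy.symm
      subst this; omega) (by omega)
    rw [T.dist_comm (u := m1) (v := y), T.dist_comm (u := m) (v := y)] at hy
    omega

/-- Slide `x` along the common initial part of the geodesics to `y` and `w`; where they part,
`dist_concat` applies. -/
theorem exists_median (hT : T.IsTree) (x y w : V) :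
    ∃ m, T.dist x m + T.dist m y = T.dist x y ∧ T.dist x m + T.dist m w = T.dist x w ∧
      T.dist y m + T.dist m w = T.dist y w := by
  induction hn : T.dist x y generalizing x with
  | zero =>
    have := hT.1.dist_eq_zero_iff.1 hn
    subst this
    exact ⟨x, by simp⟩
  | succ n ih =>
    by_cases hc : ∃ v, T.Adj x v ∧ T.dist v y + 1 = T.dist x y ∧ T.dist v w + 1 = T.dist x w
    · obtain ⟨v, hv, h1, h2⟩ := hc
      obtain ⟨m, e1, e2, e3⟩ := ih v (by omega)
      have t1 := hT.1.dist_triangle (u := x) (v := v) (w := m)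
      have t2 := hT.1.dist_triangle (u := x) (v := m) (w := y)
      have t3 := hT.1.dist_triangle (u := x) (v := m) (w := w)
      have t4 := SimpleGraph.dist_eq_one_iff_adj.2 hv
      exact ⟨m, by omega, by omega, e3⟩
    · refine ⟨x, by simpa using hn, by simp, (dist_concat hT fun v hv hvy => ?_).symm⟩
      rcases dist_adj_cases hT w hv with h | h
      · exact absurd ⟨v, hv, hvy, h⟩ hc
      · exact h

/-- This is uniqueness of geodesics, obtained by peeling off the common first edge. -/
theorem eq_of_dist_eq (hT : T.IsTree) {x y m m' : V}
    (h : T.dist x m + T.dist m y = T.dist x y) (h' : T.dist x m' + T.dist m' y = T.dist x y)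
    (hd : T.dist x m = T.dist x m') : m = m' := by
  induction hn : T.dist x m generalizing x with
  | zero =>
    rw [hn] at hd
    exact (hT.1.dist_eq_zero_iff.1 hn).symm.trans (hT.1.dist_eq_zero_iff.1 hd.symm)
  | succ n ih =>
    have key : ∀ z, T.dist x z + T.dist z y = T.dist x y → T.dist x z = n + 1 →
        ∃ v, T.Adj x v ∧ T.dist v z = n ∧ T.dist v y + 1 = T.dist x y := by
      intro z hz hz'
      have hne : x ≠ z := by rintro rfl; simp at hz'
      obtain ⟨v, hv, hvz⟩ := exists_next hT hne
      have t1 := hT.1.dist_triangle (u := x) (v := v) (w := y)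
      have t2 := hT.1.dist_triangle (u := v) (v := z) (w := y)
      have t4 := SimpleGraph.dist_eq_one_iff_adj.2 hv
      exact ⟨v, hv, by omega, by omega⟩
    obtain ⟨v, hv, h1, h2⟩ := key m h hn
    obtain ⟨v', hv', h1', h2'⟩ := key m' h' (by omega)
    have : v = v' := next_unique hT hv hv' h2 h2'
    subst this
    exact ih (by omega) (by omega) (by omega) h1

/-- A set of vertices is convex if it contains all geodesics between its points. -/
def IsConvex (T : SimpleGraph V) (A : Set V) : Prop :=
  ∀ x ∈ A, ∀ y ∈ A, ∀ z, T.dist x z + T.dist z y = T.dist x y → z ∈ A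

theorem IsConvex.next_mem {A : Set V} (hA : IsConvex T A) {x y v : V}
    (hx : x ∈ A) (hy : y ∈ A) (hv : T.Adj x v) (hd : T.dist v y + 1 = T.dist x y) : v ∈ A := by
  have := SimpleGraph.dist_eq_one_iff_adj.2 hv
  exact hA x hx y hy v (by omega)

theorem IsConvex.connected (hT : T.IsTree) {A : Set V} (hA : IsConvex T A) (hne : A.Nonempty) :
    (T.induce A).Connected := by
  obtain ⟨y, hy⟩ := hne
  have : Nonempty A := ⟨⟨y, hy⟩⟩
  have key : ∀ n, ∀ x (hx : x ∈ A), T.dist x y = n →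
      (T.induce A).Reachable ⟨x, hx⟩ ⟨y, hy⟩ := by
    intro n
    induction n with
    | zero =>
      intro x hx h
      have := hT.1.dist_eq_zero_iff.1 h
      subst this
      exact SimpleGraph.Reachable.refl _
    | succ n ih =>
      intro x hx h
      have hne : x ≠ y := by rintro rfl; simp at h
      obtain ⟨v, hv, hd⟩ := exists_next hT hne
      have hvA := hA.next_mem hx hy hv hd
      have h1 : (T.induce A).Adj ⟨x, hx⟩ ⟨v, hvA⟩ := by simpa using hv
      exact h1.reachable.trans (ih v hvA (by omega))
  exact ⟨fun a b => (key _ a.1 a.2 rfl).trans (key _ b.1 b.2 rfl).symm⟩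

/-- Take `g` nearest to `x`. The median of `x`, `a`, `g` lies in `A` by convexity and is no farther
from `x` than `g`, so it is `g`. -/
theorem IsConvex.exists_gate (hT : T.IsTree) {A : Set V} (hA : IsConvex T A) (hne : A.Nonempty)
    (x : V) : ∃ g ∈ A, ∀ a ∈ A, T.dist x a = T.dist x g + T.dist g a := by
  classical
  have hex : ∃ n, ∃ g ∈ A, T.dist x g = n := ⟨_, hne.some, hne.some_mem, rfl⟩
  obtain ⟨g, hg, hgn⟩ := Nat.find_spec hex
  refine ⟨g, hg, fun a ha => ?_⟩
  obtain ⟨m, e1, e2, e3⟩ := exists_median hT x a g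
  have hm : m ∈ A := hA a ha g hg m e3
  have hmin := Nat.find_min' hex ⟨m, hm, rfl⟩
  have : m = g := hT.1.dist_eq_zero_iff.1 (by omega)
  subst this
  exact e1.symm

/-- The half-tree of the vertices closer to `v` than to `u`. -/
def halfTree (T : SimpleGraph V) (u v : V) : Set V :=
  {w | T.dist w v < T.dist w u}

theorem mem_halfTree_iff (hT : T.IsTree) {u v : V} (h : T.Adj u v) (w : V) :
    w ∈ halfTree T u v ↔ T.dist w u = T.dist w v + 1 := by
  have := dist_adj_cases hT w h
  rw [T.dist_comm (v := w), T.dist_comm (v := w)] at this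
  simp only [halfTree, Set.mem_ofPred_eq]; omega

theorem notMem_halfTree_iff (hT : T.IsTree) {u v : V} (h : T.Adj u v) (w : V) :
    w ∉ halfTree T u v ↔ T.dist w v = T.dist w u + 1 := by
  have := dist_adj_cases hT w h
  rw [T.dist_comm (v := w), T.dist_comm (v := w)] at this
  simp only [halfTree, Set.mem_ofPred_eq]; omega

theorem mem_halfTree_symm (hT : T.IsTree) {u v : V} (h : T.Adj u v) (w : V) :
    w ∈ halfTree T v u ↔ w ∉ halfTree T u v := by
  rw [notMem_halfTree_iff hT h, mem_halfTree_iff hT h.symm]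

theorem left_notMem_halfTree {u v : V} : u ∉ halfTree T u v := by
  simp [halfTree]

theorem dist_cross (hT : T.IsTree) {u v w w' : V} (h : T.Adj u v) (hw : w ∈ halfTree T u v)
    (hw' : w' ∉ halfTree T u v) : T.dist w w' = T.dist w v + 1 + T.dist u w' := by
  rw [mem_halfTree_iff hT h] at hw
  rw [notMem_halfTree_iff hT h] at hw'
  have := dist_concat hT (y := w) (m := u) (w := w') (fun x hx hxw => by
    rw [T.dist_comm (u := x), T.dist_comm (u := u) (v := w)] at hxw
    have : x = v := next_unique hT hx h (w := w)
      (by rw [T.dist_comm (u := x), T.dist_comm (u := u)]; exact hxw)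
      (by rw [T.dist_comm (u := v), T.dist_comm (u := u)]; exact hw.symm)
    subst this
    rw [T.dist_comm (u := x), T.dist_comm (u := u)]; exact hw')
  omega

theorem isConvex_halfTree (hT : T.IsTree) {u v : V} (h : T.Adj u v) :
    IsConvex T (halfTree T u v) := by
  intro x hx y hy z hz
  by_contra hc
  have h1 := dist_cross hT h hx hc
  have h2 := dist_cross hT h hy hc
  rw [mem_halfTree_iff hT h] at hx hy
  have t := hT.1.dist_triangle (u := x) (v := v) (w := y)
  rw [T.dist_comm (u := z) (v := y)] at hz
  rw [T.dist_comm (u := v) (v := y)] at t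
  omega

/-- A convex set that meets both sides of an edge contains the edge. -/
theorem IsConvex.edge_mem (hT : T.IsTree) {A : Set V} (hA : IsConvex T A) {u v x y : V}
    (h : T.Adj u v) (hx : x ∈ A) (hy : y ∈ A) (hxH : x ∈ halfTree T u v)
    (hyH : y ∉ halfTree T u v) : u ∈ A ∧ v ∈ A := by
  have h0 := dist_cross hT h hxH hyH
  have h1 := (mem_halfTree_iff hT h x).1 hxH
  have h2 := (notMem_halfTree_iff hT h y).1 hyH
  refine ⟨hA x hx y hy u (by omega), hA x hx y hy v ?_⟩
  rw [T.dist_comm (u := y) (v := v), T.dist_comm (u := y) (v := u)] at h2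
  omega

theorem isConvex_segment (hT : T.IsTree) (a b : V) : IsConvex T (segment T a b) := by
  intro x hx y hy z hz
  simp only [segment, Set.mem_ofPred_eq] at *
  obtain ⟨m, e1, e2, e3⟩ := exists_median hT a b z
  by_cases hmz : m = z
  · subst hmz; exact e1
  · exfalso
    obtain ⟨v, hv, hd⟩ := exists_next hT (Ne.symm hmz)
    -- The edge from `z` towards its projection `m` has `a` and `b` on the side away from `z`. A
    -- vertex of `[a, b]` beyond it would force the geodesic to cross the edge twice.
    have hnot : ∀ w, T.dist a w + T.dist w b = T.dist a b → w ∉ halfTree T v z := by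
      intro w hw hwH
      have hav : a ∉ halfTree T v z := by
        rw [notMem_halfTree_iff hT hv.symm]
        have t1 := hT.1.dist_triangle (u := a) (v := m) (w := v)
        have t2 := hT.1.dist_triangle (u := a) (v := v) (w := z)
        rw [T.dist_comm (u := v) (v := m)] at hd
        rw [T.dist_comm (u := z) (v := m)] at hd
        have := SimpleGraph.dist_eq_one_iff_adj.2 hv.symm
        omega
      have hbv : b ∉ halfTree T v z := by
        rw [notMem_halfTree_iff hT hv.symm]
        have t1 := hT.1.dist_triangle (u := b) (v := m) (w := v)
        have t2 := hT.1.dist_triangle (u := b) (v := v) (w := z)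
        rw [T.dist_comm (u := v) (v := m)] at hd
        rw [T.dist_comm (u := z) (v := m)] at hd
        have := SimpleGraph.dist_eq_one_iff_adj.2 hv.symm
        omega
      have c1 := dist_cross hT hv.symm hwH hav
      have c2 := dist_cross hT hv.symm hwH hbv
      have t := hT.1.dist_triangle (u := a) (v := v) (w := b)
      rw [T.dist_comm (u := w) (v := a)] at c1
      rw [T.dist_comm (u := v) (v := a)] at c1
      omega
    have hx' := hnot x hx
    have hy' := hnot y hy
    rw [← mem_halfTree_symm hT hv.symm] at hx' hy'
    have := isConvex_halfTree hT hv x hx' y hy' z hz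
    exact left_notMem_halfTree this

theorem left_mem_segment (a b : V) : a ∈ segment T a b := by simp [segment]

theorem right_mem_segment (a b : V) : b ∈ segment T a b := by simp [segment]

theorem segment_finite (hT : T.IsTree) (a b : V) : (segment T a b).Finite := by
  have : Set.InjOn (T.dist a) (segment T a b) := fun x hx y hy h => eq_of_dist_eq hT hx hy h
  refine Set.Finite.of_finite_image ((Set.finite_Iic (T.dist a b)).subset ?_) this
  rintro _ ⟨x, hx, rfl⟩
  simp only [segment, Set.mem_ofPred_eq] at hx
  simp only [Set.mem_Iic]; omega

/-- A finite set of vertices lies in a finite convex set. -/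
theorem exists_finite_convex (hT : T.IsTree) {P : Set V} (hP : P.Finite) (a : V) :
    ∃ F : Set V, F.Finite ∧ IsConvex T F ∧ P ⊆ F ∧ a ∈ F := by
  refine ⟨{a} ∪ ⋃ p ∈ P, segment T a p, (Set.finite_singleton a).union
    (hP.biUnion fun p _ => segment_finite hT a p), ?_, ?_, by simp⟩
  · have star : ∀ x ∈ ({a} ∪ ⋃ p ∈ P, segment T a p : Set V), ∀ z, z ∈ segment T a x →
        z ∈ ({a} ∪ ⋃ p ∈ P, segment T a p : Set V) := by
      rintro x (hx | hx) z hz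
      · rw [Set.mem_singleton_iff] at hx
        subst hx
        simp only [segment, Set.mem_ofPred_eq, SimpleGraph.dist_self] at hz
        exact Or.inl ((hT.1.dist_eq_zero_iff.1 (by omega : T.dist x z = 0)).symm)
      · simp only [Set.mem_iUnion] at hx
        obtain ⟨p, hp, hx⟩ := hx
        refine Or.inr (Set.mem_iUnion₂.2 ⟨p, hp, ?_⟩)
        exact isConvex_segment hT a p a (left_mem_segment a p) x hx z hz
    intro x hx y hy z hz
    -- A geodesic triangle is a tripod: `[x, y]` is covered by `[a, x]` and `[a, y]`. Otherwise the
    -- geodesics from `z` to `x` and to `y` would start with the same edge, the one towards `a`.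
    have hzm : z ∈ segment T a x ∨ z ∈ segment T a y := by
      obtain ⟨k, f1, f2, f3⟩ := exists_median hT x y z
      have hk : k = z := by
        have : T.dist k z = 0 := by
          rw [T.dist_comm (u := y) (v := k)] at f3
          rw [T.dist_comm (u := y) (v := z), T.dist_comm (u := k) (v := z)] at f3
          rw [T.dist_comm (u := k) (v := z)] at f2 ⊢
          omega
        exact hT.1.dist_eq_zero_iff.1 this
      subst hk
      obtain ⟨n, n1, n2, n3⟩ := exists_median hT a x k
      obtain ⟨n', o1, o2, o3⟩ := exists_median hT a y k
      by_cases h1 : n = k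
      · subst h1; exact Or.inl n1
      by_cases h2 : n' = k
      · subst h2; exact Or.inr o1
      exfalso
      obtain ⟨v, hv, hvd⟩ := exists_next hT (Ne.symm h1)
      obtain ⟨v', hv', hvd'⟩ := exists_next hT (Ne.symm h2)
      have A1 : T.dist v a + 1 = T.dist k a := by
        have := SimpleGraph.dist_eq_one_iff_adj.2 hv
        have t1 := hT.1.dist_triangle (u := k) (v := v) (w := a)
        have t2 := hT.1.dist_triangle (u := v) (v := n) (w := a)
        rw [T.dist_comm (u := n) (v := a)] at t2
        rw [T.dist_comm (u := k) (v := a)] at t1 ⊢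
        rw [T.dist_comm (u := n) (v := k)] at n2
        omega
      have A2 : T.dist v' a + 1 = T.dist k a := by
        have := SimpleGraph.dist_eq_one_iff_adj.2 hv'
        have t1 := hT.1.dist_triangle (u := k) (v := v') (w := a)
        have t2 := hT.1.dist_triangle (u := v') (v := n') (w := a)
        rw [T.dist_comm (u := n') (v := a)] at t2
        rw [T.dist_comm (u := k) (v := a)] at t1 ⊢
        rw [T.dist_comm (u := n') (v := k)] at o2
        omega
      have hvv : v = v' := next_unique hT hv hv' A1 A2
      subst hvv
      have := SimpleGraph.dist_eq_one_iff_adj.2 hv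
      have t1 := hT.1.dist_triangle (u := v) (v := n) (w := x)
      have t2 := hT.1.dist_triangle (u := v) (v := n') (w := y)
      have t3 := hT.1.dist_triangle (u := x) (v := v) (w := y)
      rw [T.dist_comm (u := n) (v := x)] at t1
      rw [T.dist_comm (u := n') (v := y)] at t2
      rw [T.dist_comm (u := n) (v := k)] at n3
      rw [T.dist_comm (u := n') (v := k)] at o3
      rw [T.dist_comm (u := y) (v := k)] at o3
      rw [T.dist_comm (u := v) (v := x)] at t1
      omega
    rcases hzm with h | h
    · exact star x hx z h
    · exact star y hy z h
  · intro p hp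
    exact Or.inr (Set.mem_iUnion₂.2 ⟨p, hp, right_mem_segment a p⟩)

/-! ### Lines -/

/-- An isometrically embedded line. -/
def IsLine (T : SimpleGraph V) (f : ℤ → V) : Prop :=
  ∀ m n, T.dist (f m) (f n) = (m - n).natAbs

theorem isLine_of_adj (hT : T.IsTree) {f : ℤ → V} (hadj : ∀ n, T.Adj (f n) (f (n + 1)))
    (hne : ∀ n, f (n + 2) ≠ f n) : IsLine T f := by
  have key : ∀ (k : ℕ) (m : ℤ), T.dist (f (m + k)) (f m) = k ∧
      T.dist (f (m + k + 1)) (f m) = k + 1 := by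
    intro k m
    induction k with
    | zero =>
      have := SimpleGraph.dist_eq_one_iff_adj.2 (hadj m).symm
      simp [this]
    | succ k ih =>
      have e : m + ((k + 1 : ℕ) : ℤ) = m + k + 1 := by push_cast; ring
      rw [e]
      refine ⟨by simpa using ih.2, ?_⟩
      have := dist_of_turn hT (w := f m) (hadj (m + k)) (hadj (m + k + 1))
        (by rw [add_assoc]; exact hne (m + k)) (by rw [ih.1, ih.2])
      rw [this, ih.2]
  intro m n
  rcases le_total m n with h | h
  · have := (key (n - m).toNat m).1
    rw [T.dist_comm, show m + ((n - m).toNat : ℤ) = n by omega] at this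
    omega
  · have := (key (m - n).toNat n).1
    rw [show n + ((m - n).toNat : ℤ) = m by omega] at this
    omega

theorem isLine_of_injective (hT : T.IsTree) {f : ℤ → V} (hf : Function.Injective f)
    (hadj : ∀ n, T.Adj (f n) (f (n + 1))) : IsLine T f :=
  isLine_of_adj hT hadj fun n h => by have := hf h; omega

theorem IsLine.adj {f : ℤ → V} (hf : IsLine T f) (n : ℤ) : T.Adj (f n) (f (n + 1)) := by
  rw [← SimpleGraph.dist_eq_one_iff_adj, hf]; omega

theorem IsLine.injective {f : ℤ → V} (hf : IsLine T f) :
    Function.Injective f := by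
  intro m n h
  have := hf m n
  rw [h, SimpleGraph.dist_self] at this
  omega

theorem IsLine.neg {f : ℤ → V} (hf : IsLine T f) : IsLine T fun n => f (-n) := by
  intro m n
  rw [hf]; omega

theorem IsLine.isConvex (hT : T.IsTree) {f : ℤ → V} (hf : IsLine T f) :
    IsConvex T (Set.range f) := by
  rintro _ ⟨m, rfl⟩ _ ⟨n, rfl⟩ z hz
  have h1 := hf m n
  rcases le_total m n with h | h
  · refine ⟨m + T.dist (f m) z, (eq_of_dist_eq hT hz ?_ ?_).symm⟩
    · rw [hf, hf, hf]; omega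
    · rw [hf]; omega
  · refine ⟨m - T.dist (f m) z, (eq_of_dist_eq hT hz ?_ ?_).symm⟩
    · rw [hf, hf, hf]; omega
    · rw [hf]; omega

/-- The integer `p y` is the parameter of the nearest point of the line; the dynamics of
translations is read off from it. -/
theorem IsLine.exists_proj (hT : T.IsTree) {f : ℤ → V} (hf : IsLine T f) :
    ∃ p : V → ℤ, ∀ y n, T.dist y (f n) = T.dist y (f (p y)) + (p y - n).natAbs := by
  have : ∀ y, ∃ k : ℤ, ∀ n, T.dist y (f n) = T.dist y (f k) + (k - n).natAbs := by
    intro y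
    obtain ⟨_, ⟨k, rfl⟩, hk⟩ := (hf.isConvex hT).exists_gate hT ⟨f 0, 0, rfl⟩ y
    exact ⟨k, fun n => by rw [hk _ ⟨n, rfl⟩, hf]⟩
  choose p hp using this
  exact ⟨p, hp⟩

/-- The neighbours of a vertex of a line that lie on the line. -/
theorem IsLine.adj_iff {f : ℤ → V} (hf : IsLine T f) (m n : ℤ) :
    T.Adj (f m) (f n) ↔ n = m + 1 ∨ n = m - 1 := by
  rw [← SimpleGraph.dist_eq_one_iff_adj, hf]; omega

end Tree

end BassSerre

namespace BassSerre

/-! ### Groups acting on trees -/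

section Action

variable {G : Type*} [Group G] {V : Type*} [MulAction G V] {T : SimpleGraph V}

/-- `G` acts on `T` by graph automorphisms. -/
def ActsOn (G : Type*) [Group G] {V : Type*} [MulAction G V] (T : SimpleGraph V) : Prop :=
  ∀ (g : G) (u v : V), T.Adj u v → T.Adj (g • u) (g • v)

/-- No element of `G` exchanges the endpoints of an edge. -/
def NoInversion (G : Type*) [Group G] {V : Type*} [MulAction G V] (T : SimpleGraph V) : Prop :=
  ∀ (g : G) (u v : V), T.Adj u v → ¬ (g • u = v ∧ g • v = u)

theorem adj_smul (hact : ActsOn G T) (g : G) {u v : V} : T.Adj (g • u) (g • v) ↔ T.Adj u v :=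
  ⟨fun h => by simpa using hact g⁻¹ _ _ h, hact g u v⟩

theorem dist_smul_le (hT : T.IsTree) (hact : ActsOn G T) (g : G) (u v : V) :
    T.dist (g • u) (g • v) ≤ T.dist u v := by
  induction hn : T.dist u v generalizing u with
  | zero => rw [hT.1.dist_eq_zero_iff.1 hn]; simp
  | succ n ih =>
    have hne : u ≠ v := by rintro rfl; simp at hn
    obtain ⟨x, hx, hd⟩ := exists_next hT hne
    have h1 := ih x (by omega)
    have h2 := SimpleGraph.dist_eq_one_iff_adj.2 (hact g _ _ hx)
    have h3 := hT.1.dist_triangle (u := g • u) (v := g • x) (w := g • v)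
    omega

theorem dist_smul (hT : T.IsTree) (hact : ActsOn G T) (g : G) (u v : V) :
    T.dist (g • u) (g • v) = T.dist u v :=
  le_antisymm (dist_smul_le hT hact g u v)
    (by simpa using dist_smul_le hT hact g⁻¹ (g • u) (g • v))

theorem smul_mem_segment (hT : T.IsTree) (hact : ActsOn G T) (g : G) {u v w : V} :
    g • w ∈ segment T (g • u) (g • v) ↔ w ∈ segment T u v := by
  simp only [segment, Set.mem_ofPred_eq, dist_smul hT hact]

theorem smul_mem_halfTree (hT : T.IsTree) (hact : ActsOn G T) (g : G) {u v w : V} :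
    g • w ∈ halfTree T (g • u) (g • v) ↔ w ∈ halfTree T u v := by
  simp only [halfTree, Set.mem_ofPred_eq, dist_smul hT hact]

theorem IsConvex.smul (hT : T.IsTree) (hact : ActsOn G T) {A : Set V} (hA : IsConvex T A)
    (g : G) : IsConvex T (g • A) := by
  intro x hx y hy z hz
  rw [Set.mem_smul_set_iff_inv_smul_mem] at *
  exact hA _ hx _ hy _ (by simpa only [dist_smul hT hact] using hz)

theorem IsLine.smul (hT : T.IsTree) (hact : ActsOn G T) {f : ℤ → V} (hf : IsLine T f) (g : G) :
    IsLine T fun n => g • f n := by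
  intro m n
  rw [dist_smul hT hact, hf]

theorem isConvex_fixedBy (hT : T.IsTree) (hact : ActsOn G T) (g : G) :
    IsConvex T {v : V | g • v = v} := by
  intro x hx y hy z hz
  simp only [Set.mem_ofPred_eq] at *
  have h1 := dist_smul hT hact g x z
  have h2 := dist_smul hT hact g z y
  rw [hx] at h1; rw [hy] at h2
  exact eq_of_dist_eq hT (by omega : T.dist x (g • z) + T.dist (g • z) y = T.dist x y) hz h1

/-- An elliptic element fixes the midpoint of the segment from a vertex to its image. -/
theorem exists_fixed_midpoint (hT : T.IsTree) (hact : ActsOn G T) {a : G}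
    (ha : ∃ v : V, a • v = v) (w : V) :
    ∃ m, a • m = m ∧ T.dist w m = T.dist m (a • w) ∧
      T.dist w m + T.dist m (a • w) = T.dist w (a • w) := by
  obtain ⟨m, hm, hgate⟩ := (isConvex_fixedBy hT hact a).exists_gate hT ha w
  simp only [Set.mem_ofPred_eq] at hm hgate
  have e : T.dist m (a • w) = T.dist m w := by
    conv_lhs => rw [← hm]
    exact dist_smul hT hact a m w
  refine ⟨m, hm, by rw [e, T.dist_comm], ?_⟩
  refine (dist_concat hT fun v hv hvw => ?_).symm
  rcases dist_adj_cases hT (a • w) hv with h | h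
  -- If the geodesics from `m` to `w` and to `a • w` shared their first edge `mv`, then `a` would
  -- fix `v`, a fixed vertex closer to `w` than `m`.
  · exfalso
    have h1 : T.Adj m (a • v) := by simpa [hm] using hact a _ _ hv
    have h2 : T.dist (a • v) (a • w) + 1 = T.dist m (a • w) := by
      rw [dist_smul hT hact, hvw, e]
    have h3 := next_unique hT hv h1 h h2
    have h4 := hgate v h3.symm
    rw [T.dist_comm (u := w) (v := v), T.dist_comm (u := w) (v := m)] at h4
    omega
  · exact h

/-- Two elliptic elements whose product is elliptic have a common fixed vertex. -/
theorem exists_common_fixed (hT : T.IsTree) (hact : ActsOn G T) {a b : G}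
    (ha : ∃ v : V, a • v = v) (hb : ∃ v : V, b • v = v) (hab : ∃ v : V, (b * a) • v = v) :
    ∃ v : V, a • v = v ∧ b • v = v := by
  obtain ⟨w, hw⟩ := hab
  have hb' : ∃ v : V, b⁻¹ • v = v := hb.imp fun v hv => inv_smul_eq_iff.2 hv.symm
  -- The elements `a` and `b⁻¹` carry `w` to the same vertex, so their fixed midpoints coincide.
  have hw' : b⁻¹ • w = a • w := by rw [inv_smul_eq_iff, ← mul_smul, hw]
  obtain ⟨m, h1, h2, h3⟩ := exists_fixed_midpoint hT hact ha w
  obtain ⟨m', h1', h2', h3'⟩ := exists_fixed_midpoint hT hact hb' w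
  rw [hw'] at h2' h3'
  have : m = m' := eq_of_dist_eq hT h3 h3' (by omega)
  subst this
  exact ⟨m, h1, (inv_smul_eq_iff.1 h1').symm⟩

theorem exists_geodesic (hT : T.IsTree) (u w : V) :
    ∃ g : ℕ → V, g 0 = u ∧ (∀ i ≤ T.dist u w, T.dist (g i) w = T.dist u w - i) ∧
      ∀ i < T.dist u w, T.Adj (g i) (g (i + 1)) := by
  induction hn : T.dist u w generalizing u with
  | zero => exact ⟨fun _ => u, rfl, fun i _ => by simp [hn], fun i hi => by omega⟩
  | succ n ih =>
    have hne : u ≠ w := by rintro rfl; simp at hn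
    obtain ⟨x, hx, hd⟩ := exists_next hT hne
    obtain ⟨g, h0, h1, h2⟩ := ih x (by omega)
    refine ⟨fun i => Nat.casesOn i u g, rfl, ?_, ?_⟩
    · rintro (_ | i) hi
      · simpa using hn
      · have := h1 i (by omega)
        simp only
        omega
    · rintro (_ | i) hi
      · simpa [h0] using hx
      · exact h2 i (by omega)

/-- An automorphism without fixed vertex that is not an inversion translates a line. -/
theorem exists_line (hT : T.IsTree) (hact : ActsOn G T) (hinv : NoInversion G T) {t : G}
    (ht : ¬ ∃ v : V, t • v = v) :
    ∃ (f : ℤ → V) (k : ℤ), IsLine T f ∧ 0 < k ∧ ∀ n, t • f n = f (n + k) := by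
  classical
  have hex : ∃ n, ∃ u : V, T.dist u (t • u) = n := ⟨_, hT.1.nonempty.some, rfl⟩
  obtain ⟨u, hu⟩ := Nat.find_spec hex
  have hmin : ∀ x, T.dist u (t • u) ≤ T.dist x (t • x) := fun x => by
    rw [hu]; exact Nat.find_min' hex ⟨x, rfl⟩
  clear hu
  obtain ⟨g, g0, g1, g2⟩ := exists_geodesic hT u (t • u)
  set k := T.dist u (t • u) with hk
  have kpos : 0 < k := by
    rcases Nat.eq_zero_or_pos k with h | h
    · exact absurd ⟨u, (hT.1.dist_eq_zero_iff.1 h).symm⟩ ht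
    · exact h
  have gk : g k = t • u := hT.1.dist_eq_zero_iff.1 (by simpa using g1 k le_rfl)
  have gle : ∀ j i, i + j ≤ k → T.dist (g i) (g (i + j)) ≤ j := by
    intro j
    induction j with
    | zero => intro i _; simp
    | succ j ih =>
      intro i hij
      have h1 := ih i (by omega)
      have h2 := SimpleGraph.dist_eq_one_iff_adj.2 (g2 (i + j) (by omega))
      have h3 := hT.1.dist_triangle (u := g i) (v := g (i + j)) (w := g (i + j + 1))
      rw [← add_assoc]
      omega
  -- The translates of the geodesic from a vertex `u` of minimal displacement to `t • u`, put end to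
  -- end.
  let f : ℤ → V := fun n => t ^ (n / (k : ℤ)) • g (n % (k : ℤ)).toNat
  have hf : ∀ (q : ℤ) (r : ℕ), r ≤ k → f (q * k + r) = t ^ q • g r := by
    intro q r hr
    rcases hr.lt_or_eq with h | h
    · have h1 : (q * k + r) / (k : ℤ) = q := by
        rw [Int.add_ediv_of_dvd_left (Dvd.intro_left _ rfl), Int.mul_ediv_cancel _ (by omega),
          Int.ediv_eq_zero_of_lt (by omega) (by omega), add_zero]
      have h2 : (q * k + r) % (k : ℤ) = r := by
        rw [Int.add_comm, Int.add_mul_emod_self_right, Int.emod_eq_of_lt (by omega) (by omega)]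
      simp only [f, h1, h2, Int.toNat_natCast]
    · subst h
      have h1 : (q * k + k) / (k : ℤ) = q + 1 := by
        rw [show q * (k : ℤ) + k = (q + 1) * k by ring, Int.mul_ediv_cancel _ (by omega)]
      have h2 : (q * k + k) % (k : ℤ) = 0 := by
        rw [show q * (k : ℤ) + k = (q + 1) * k by ring, Int.mul_emod_left]
      simp only [f, h1, h2, gk, Int.toNat_zero, g0, zpow_add_one, mul_smul]
  have hdecomp : ∀ n : ℤ, ∃ (q : ℤ) (r : ℕ), r < k ∧ n = q * k + r := by
    intro n
    have h0 := Int.emod_nonneg n (by omega : (k : ℤ) ≠ 0)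
    have h1 := Int.emod_lt_of_pos n (by omega : (0 : ℤ) < k)
    refine ⟨n / k, (n % k).toNat, by omega, ?_⟩
    rw [Int.toNat_of_nonneg h0]
    exact (Int.ediv_mul_add_emod n k).symm
  refine ⟨f, k, isLine_of_adj hT ?_ ?_, by omega, ?_⟩
  · intro n
    obtain ⟨q, r, hr, rfl⟩ := hdecomp n
    have e : q * (k : ℤ) + r + 1 = q * k + ((r + 1 : ℕ) : ℤ) := by push_cast; ring
    rw [e, hf q r hr.le, hf q (r + 1) hr]
    exact hact _ _ _ (g2 r hr)
  · intro n h
    obtain ⟨q, r, hr, rfl⟩ := hdecomp n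
    by_cases hr2 : r + 2 ≤ k
    · have e : q * (k : ℤ) + r + 2 = q * k + ((r + 2 : ℕ) : ℤ) := by push_cast; ring
      rw [e, hf q r hr.le, hf q (r + 2) hr2] at h
      have h1 := g1 r hr.le
      have h2 := g1 (r + 2) hr2
      rw [MulAction.injective _ h] at h2
      omega
    -- Backtracking at a junction would make `t` invert an edge if `k = 1`, and would give `g 1` a
    -- displacement at most `k - 2` otherwise.
    · have hr1 : r + 1 = k := by omega
      have e : q * (k : ℤ) + r + 2 = (q + 1) * k + ((1 : ℕ) : ℤ) := by
        rw [← hr1]; push_cast; ring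
      rw [e, hf q r hr.le, hf (q + 1) 1 kpos, zpow_add_one, mul_smul] at h
      have h := MulAction.injective _ h
      by_cases hk1 : k = 1
      · have : r = 0 := by omega
        subst this
        rw [hk1] at gk
        rw [g0, gk] at h
        have hadj := g2 0 kpos
        rw [g0, zero_add, gk] at hadj
        exact hinv t u (t • u) hadj ⟨rfl, h⟩
      · have h1 := hmin (g 1)
        have h2 := gle (r - 1) 1 (by omega)
        rw [show 1 + (r - 1) = r by omega, ← h] at h2
        omega
  · intro n
    obtain ⟨q, r, hr, rfl⟩ := hdecomp n
    rw [show q * (k : ℤ) + r + k = (q + 1) * k + r by ring, hf q r hr.le, hf _ r hr.le,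
      ← mul_smul, zpow_add, zpow_one, (Commute.refl t).zpow_right q |>.eq]

theorem zpow_smul_line {t : G} {f : ℤ → V} {k : ℤ} (h : ∀ n, t • f n = f (n + k)) (j n : ℤ) :
    t ^ j • f n = f (n + j * k) := by
  induction j using Int.induction_on generalizing n with
  | zero => simp
  | succ i ih => rw [zpow_add_one, mul_smul, h, ih]; congr 1; ring
  | pred i ih =>
    rw [zpow_sub_one, mul_smul]
    have : t⁻¹ • f n = f (n - k) := by rw [inv_smul_eq_iff, h]; congr 1; ring
    rw [this, ih]; congr 1; ring

theorem neg_line {t : G} {f : ℤ → V} {k : ℤ} (h : ∀ n, t • f n = f (n + k)) (n : ℤ) :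
    t • f (-n) = f (-(n + -k)) := by rw [h]; congr 1; ring

theorem conj_line {t : G} {f : ℤ → V} {k : ℤ} (h : ∀ n, t • f n = f (n + k)) (b : G) (n : ℤ) :
    (b * t * b⁻¹) • (b • f n) = b • f (n + k) := by
  rw [← mul_smul, inv_mul_cancel_right, mul_smul, h]

theorem proj_smul (hT : T.IsTree) (hact : ActsOn G T) {t : G} {f : ℤ → V} {k : ℤ}
    (h : ∀ n, t • f n = f (n + k)) {p : V → ℤ}
    (hp : ∀ y n, T.dist y (f n) = T.dist y (f (p y)) + (p y - n).natAbs) (y : V) :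
    p (t • y) = p y + k := by
  have h1 := hp (t • y) (p y + k)
  have h2 := hp y (p (t • y) - k)
  rw [← h, dist_smul hT hact] at h1
  have h3 := dist_smul hT hact t y (f (p (t • y) - k))
  rw [h, sub_add_cancel] at h3
  omega

theorem IsLine.dist_of_proj_ne (hT : T.IsTree) {f : ℤ → V} (hf : IsLine T f) {p : V → ℤ}
    (hp : ∀ y n, T.dist y (f n) = T.dist y (f (p y)) + (p y - n).natAbs) {y y' : V}
    (h : p y ≠ p y') :
    T.dist y y' = T.dist y (f (p y)) + (p y - p y').natAbs + T.dist (f (p y')) y' := by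
  have key : ∀ y y', p y < p y' →
      T.dist y y' = T.dist y (f (p y)) + (p y - p y').natAbs + T.dist (f (p y')) y' := by
    intro y y' hlt
    have a1 := hp y (p y + 1)
    have a2 := hp y' (p y)
    have a3 := hp y' (p y + 1)
    have hy : y ∉ halfTree T (f (p y)) (f (p y + 1)) := by
      rw [notMem_halfTree_iff hT (hf.adj _)]; omega
    have hy' : y' ∈ halfTree T (f (p y)) (f (p y + 1)) := by
      rw [mem_halfTree_iff hT (hf.adj _)]; omega
    have := dist_cross hT (hf.adj _) hy' hy
    rw [T.dist_comm (u := y') (v := y), T.dist_comm (u := f (p y)) (v := y)] at this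
    rw [T.dist_comm (u := f (p y')) (v := y')]
    omega
  rcases lt_or_gt_of_ne h with h | h
  · exact key y y' h
  · have := key y' y h
    rw [T.dist_comm, this, T.dist_comm (u := y), T.dist_comm (v := y')]
    omega

theorem dist_smul_proj (hT : T.IsTree) (hact : ActsOn G T) {t : G} {f : ℤ → V} {k : ℤ}
    (hf : IsLine T f) (h : ∀ n, t • f n = f (n + k)) (hk : k ≠ 0) {p : V → ℤ}
    (hp : ∀ y n, T.dist y (f n) = T.dist y (f (p y)) + (p y - n).natAbs) (y : V) :
    T.dist y (t • y) = 2 * T.dist y (f (p y)) + k.natAbs := by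
  have h1 := proj_smul hT hact h hp y
  have h3 := dist_smul hT hact t (f (p y)) y
  have h2 := hf.dist_of_proj_ne hT hp (y := y) (y' := t • y) (by omega)
  rw [h1, ← h, h3] at h2
  rw [T.dist_comm (u := f (p y)) (v := y)] at h2
  omega

/-- The line translated by `t` is unique. -/
theorem range_line_unique (hT : T.IsTree) (hact : ActsOn G T) {t : G} {f f' : ℤ → V} {k k' : ℤ}
    (hf : IsLine T f) (h : ∀ n, t • f n = f (n + k)) (hk : k ≠ 0)
    (hf' : IsLine T f') (h' : ∀ n, t • f' n = f' (n + k')) (hk' : k' ≠ 0) :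
    Set.range f = Set.range f' := by
  have key : ∀ {f f' : ℤ → V} {k k' : ℤ}, IsLine T f → (∀ n, t • f n = f (n + k)) → k ≠ 0 →
      IsLine T f' → (∀ n, t • f' n = f' (n + k')) → k' ≠ 0 → k.natAbs ≤ k'.natAbs ∧
      (k.natAbs = k'.natAbs → Set.range f' ⊆ Set.range f) := by
    intro f f' k k' hf h hk hf' h' hk'
    obtain ⟨p, hp⟩ := hf.exists_proj hT
    -- The displacement of a vertex exceeds the translation length by twice its distance to the
    -- line, and it is constant along `f'`.
    have : ∀ n, k'.natAbs = 2 * T.dist (f' n) (f (p (f' n))) + k.natAbs := by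
      intro n
      have h1 := dist_smul_proj hT hact hf h hk hp (f' n)
      rw [h', hf'] at h1
      omega
    refine ⟨by have := this 0; omega, ?_⟩
    rintro e _ ⟨n, rfl⟩
    have := this n
    exact ⟨_, (hT.1.dist_eq_zero_iff.1 (by omega : T.dist (f' n) (f (p (f' n))) = 0)).symm⟩
  have a := key hf h hk hf' h' hk'
  have b := key hf' h' hk' hf h hk
  exact (b.2 (by omega)).antisymm (a.2 (by omega))

/-- A non-empty invariant convex set contains the translated line. -/
theorem line_subset_of_invariant (hT : T.IsTree) (hact : ActsOn G T) {t : G} {f : ℤ → V} {k : ℤ}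
    (hf : IsLine T f) (h : ∀ n, t • f n = f (n + k)) (hk : k ≠ 0) {K : Set V}
    (hK : IsConvex T K) (hne : K.Nonempty) (hinv : ∀ (j : ℤ), ∀ x ∈ K, t ^ j • x ∈ K) :
    Set.range f ⊆ K := by
  obtain ⟨p, hp⟩ := hf.exists_proj hT
  obtain ⟨x, hx⟩ := hne
  have hpt : ∀ j : ℤ, p (t ^ j • x) = p x + j * k := fun j =>
    proj_smul hT hact (zpow_smul_line h j) hp x
  rintro _ ⟨n, rfl⟩
  have habs : ∀ j : ℤ, j.natAbs ≤ (j * k).natAbs := fun j => by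
    rw [Int.natAbs_mul]; exact Nat.le_mul_of_pos_right _ (by omega)
  -- Choose `j` with `n` between the projections of `x` and `t ^ j • x`; the geodesic joining these
  -- two points of `K` then passes through `f n`.
  obtain ⟨j, hj, hj'⟩ : ∃ j : ℤ, p x ≠ p x + j * k ∧
      ((p x ≤ n ∧ n ≤ p x + j * k) ∨ (n ≤ p x ∧ p x + j * k ≤ n)) := by
    have a := habs ((n - p x).natAbs + 1)
    have b := habs (-((n - p x).natAbs + 1))
    have c : -(((n - p x).natAbs + 1 : ℤ)) * k = -((((n - p x).natAbs + 1 : ℤ)) * k) := by ring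
    by_cases hs : (p x ≤ n ∧ 0 < (((n - p x).natAbs + 1 : ℤ)) * k) ∨
        (n ≤ p x ∧ (((n - p x).natAbs + 1 : ℤ)) * k < 0)
    · exact ⟨(n - p x).natAbs + 1, by omega, by omega⟩
    · exact ⟨-((n - p x).natAbs + 1), by omega, by omega⟩
  have hd := hf.dist_of_proj_ne hT hp (y := x) (y' := t ^ j • x) (by rw [hpt]; exact hj)
  have a1 := hp x n
  have a2 := hp (t ^ j • x) n
  rw [hpt] at hd a2
  refine hK x hx _ (hinv j x hx) (f n) ?_
  rw [T.dist_comm (u := f n), hd, a1, a2, T.dist_comm (u := f (p x + j * k))]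
  omega

end Action

end BassSerre

namespace BassSerre

/-! ### Slender groups acting on trees -/

/-- A finitely generated group has finitely many homomorphisms to a group of order 2, while
`FreeGroup ι` has one for each function on `ι`. -/
theorem not_fg_freeGroup (ι : Type*) [Infinite ι] : ¬ Group.FG (FreeGroup ι) := by
  intro h
  obtain ⟨s, hs⟩ := (Group.fg_def.1 h)
  have hfin : Finite (FreeGroup ι →* Multiplicative (ZMod 2)) := by
    refine Finite.of_injective
      (fun φ : FreeGroup ι →* Multiplicative (ZMod 2) => fun x : s => φ x) ?_
    intro φ ψ e
    refine MonoidHom.eq_of_eqOn_dense hs fun x hx => ?_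
    exact congrFun e ⟨x, hx⟩
  have hfin' : Finite (ι → Multiplicative (ZMod 2)) :=
    Finite.of_equiv _ (FreeGroup.lift (α := ι) (β := Multiplicative (ZMod 2))).symm
  exact not_finite (ι → Multiplicative (ZMod 2))

theorem IsSlender.fg_of_le {G : Type*} [Group G] {A : Subgroup G} (h : IsSlender A)
    {K : Subgroup G} (hK : K ≤ A) : K.FG := by
  classical
  obtain ⟨s, hs⟩ := h (K.subgroupOf A)
  refine ⟨s.image A.subtype, ?_⟩
  rw [Finset.coe_image, ← MonoidHom.map_closure, hs, Subgroup.map_subgroupOf_eq_of_le hK]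

section Slender

variable {G : Type u} [Group G] {V : Type*} [MulAction G V] {T : SimpleGraph V}

/-- Take `x` fixed by `s` and `y` fixed by `a` as close as possible. If `x ≠ y`, some `b ∈ s` moves
the next vertex `z` towards `y`; but `a` and `b` have a common fixed vertex `w`, minimality puts `y`
on `[x, w]`, and so `b` fixes `z`. -/
theorem exists_fixed_of_finite (hT : T.IsTree) (hact : ActsOn G T) {A : Subgroup G}
    (hell : ∀ a ∈ A, ∃ v : V, a • v = v) (s : Finset G) (hs : ∀ a ∈ s, a ∈ A) :
    ∃ v : V, ∀ a ∈ s, a • v = v := by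
  classical
  induction s using Finset.induction_on with
  | empty => exact ⟨hT.1.nonempty.some, by simp⟩
  | insert a s _ ih =>
    obtain ⟨v, hv⟩ := ih fun b hb => hs b (Finset.mem_insert_of_mem hb)
    have haA := hs a (Finset.mem_insert_self a s)
    obtain ⟨v', hv'⟩ := hell a haA
    have hex : ∃ n, ∃ x y : V, (∀ b ∈ s, b • x = x) ∧ a • y = y ∧ T.dist x y = n :=
      ⟨_, v, v', hv, hv', rfl⟩
    obtain ⟨x, y, hx, hy, hxy⟩ := Nat.find_spec hex
    have hmin : ∀ x' y' : V, (∀ b ∈ s, b • x' = x') → a • y' = y' → T.dist x y ≤ T.dist x' y' :=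
      fun x' y' h1 h2 => by rw [hxy]; exact Nat.find_min' hex ⟨x', y', h1, h2, rfl⟩
    by_cases hne : x = y
    · subst hne
      refine ⟨x, fun b hb => ?_⟩
      rcases Finset.mem_insert.1 hb with rfl | hb
      · exact hy
      · exact hx b hb
    · exfalso
      obtain ⟨z, hz, hzd⟩ := exists_next hT hne
      have : ¬ ∀ b ∈ s, b • z = z := fun h => by have := hmin z y h hy; omega
      push Not at this
      obtain ⟨b, hb, hbz⟩ := this
      have hbA := hs b (Finset.mem_insert_of_mem hb)
      obtain ⟨w, haw, hbw⟩ := exists_common_fixed hT hact ⟨y, hy⟩ (hell b hbA)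
        (hell _ (A.mul_mem hbA haA))
      obtain ⟨m, e1, e2, e3⟩ := exists_median hT x y w
      have hm : a • m = m := isConvex_fixedBy hT hact a y hy w haw m e3
      have h1 := hmin x m hx hm
      have h0 : m = y := hT.1.dist_eq_zero_iff.1 (by omega)
      subst h0
      refine hbz (isConvex_fixedBy hT hact b x (hx b hb) w hbw z ?_)
      have t1 := hT.1.dist_triangle (u := z) (v := m) (w := w)
      have t2 := hT.1.dist_triangle (u := x) (v := z) (w := w)
      have t3 := SimpleGraph.dist_eq_one_iff_adj.2 hz
      omega

/-- A finitely generated group of elliptic elements is elliptic. -/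
theorem exists_fixed_of_fg (hT : T.IsTree) (hact : ActsOn G T) {A : Subgroup G} (hA : A.FG)
    (hell : ∀ a ∈ A, ∃ v : V, a • v = v) : ∃ v : V, ∀ a ∈ A, a • v = v := by
  obtain ⟨s, rfl⟩ := hA
  obtain ⟨v, hv⟩ := exists_fixed_of_finite hT hact hell s
    fun a ha => Subgroup.subset_closure ha
  refine ⟨v, fun a ha => ?_⟩
  have : Subgroup.closure (s : Set G) ≤ MulAction.stabilizer G v :=
    (Subgroup.closure_le _).2 hv
  exact this ha

/-- If the axes of two elements of a slender group, with the same translation length, share a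
ray, then they are equal. -/
theorem range_eq_of_common_ray (hT : T.IsTree) (hact : ActsOn G T) {A : Subgroup G}
    (hA : ∀ K ≤ A, K.FG) {t t' : G} (ht : t ∈ A) (ht' : t' ∈ A) {f f' : ℤ → V} {k : ℤ}
    (hf : IsLine T f) (hf' : IsLine T f') (h : ∀ n, t • f n = f (n + k))
    (h' : ∀ n, t' • f' n = f' (n + k)) (hk : k ≠ 0) {n₀ : ℤ}
    (hray : ∀ n ≥ n₀, f n ∈ Set.range f') : Set.range f = Set.range f' := by
  classical
  choose! σ hσ using hray
  have hiso : ∀ m ≥ n₀, ∀ n ≥ n₀, (σ m - σ n).natAbs = (m - n).natAbs := fun m hm n hn => by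
    rw [← hf', hσ m hm, hσ n hn, hf]
  -- The two parametrizations of the common ray may run in opposite directions; the exponent `ε =
  -- ±1` below corrects for this.
  have hsign : (∃ c, ∀ n ≥ n₀, σ n = n + c) ∨ ∃ c, ∀ n ≥ n₀, σ n = -n + c := by
    have h01 := hiso (n₀ + 1) (by omega) n₀ le_rfl
    rcases (by omega : σ (n₀ + 1) = σ n₀ + 1 ∨ σ (n₀ + 1) = σ n₀ - 1) with e | e
    · refine Or.inl ⟨σ n₀ - n₀, fun n hn => ?_⟩
      have h1 := hiso n hn n₀ le_rfl
      have h2 := hiso n hn (n₀ + 1) (by omega)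
      omega
    · refine Or.inr ⟨σ n₀ + n₀, fun n hn => ?_⟩
      have h1 := hiso n hn n₀ le_rfl
      have h2 := hiso n hn (n₀ + 1) (by omega)
      omega
  obtain ⟨ε, hε, hmove⟩ : ∃ ε : ℤ, ε ≠ 0 ∧ ∀ n ≥ n₀ + k.natAbs, t' ^ ε • f n = f (n + k) := by
    rcases hsign with ⟨c, hc⟩ | ⟨c, hc⟩
    · refine ⟨1, by omega, fun n hn => ?_⟩
      rw [← hσ n (by omega), zpow_smul_line h', ← hσ (n + k) (by omega), hc n (by omega),
        hc _ (by omega)]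
      congr 1; ring
    · refine ⟨-1, by omega, fun n hn => ?_⟩
      rw [← hσ n (by omega), zpow_smul_line h', ← hσ (n + k) (by omega), hc n (by omega),
        hc _ (by omega)]
      congr 1; ring
  -- The elements of `A` that fix some end portion of the ray. Slenderness makes `U` finitely
  -- generated, so a single portion `m ≥ B` is fixed by all of `U`.
  let U : Subgroup G :=
    { carrier := {a | a ∈ A ∧ ∃ n, ∀ m ≥ n, a • f m = f m}
      one_mem' := ⟨A.one_mem, 0, fun m _ => one_smul _ _⟩
      mul_mem' := by
        rintro a b ⟨ha, n, hn⟩ ⟨hb, n', hn'⟩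
        refine ⟨A.mul_mem ha hb, max n n', fun m hm => ?_⟩
        rw [mul_smul, hn' m (le_trans (le_max_right _ _) hm),
          hn m (le_trans (le_max_left _ _) hm)]
      inv_mem' := by
        rintro a ⟨ha, n, hn⟩
        exact ⟨A.inv_mem ha, n, fun m hm => inv_smul_eq_iff.2 (hn m hm).symm⟩ }
  obtain ⟨s, hs⟩ := hA U fun a ha => ha.1
  have hsU : ∀ a ∈ s, ∃ n, ∀ m ≥ n, a • f m = f m := fun a ha =>
    ((hs ▸ Subgroup.subset_closure ha : a ∈ U)).2
  choose! N hN using hsU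
  obtain ⟨B, hB⟩ := (s.image N).exists_le
  have hUB : ∀ a ∈ U, ∀ m ≥ B, a • f m = f m := by
    intro a ha m hm
    have hle : Subgroup.closure (s : Set G) ≤ MulAction.stabilizer G (f m) :=
      (Subgroup.closure_le _).2 fun b hb =>
        hN b hb m ((hB _ (Finset.mem_image_of_mem N hb)).trans hm)
    rw [← hs] at ha
    exact hle ha
  -- This element fixes an end portion of the ray, and so does each of its conjugates by a power of
  -- `t`. They all lie in `U`, and conjugating back spreads the fixed portion over the whole line.
  have hd : ∀ n, (t⁻¹ * t' ^ ε) • f n = f n := by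
    intro n
    obtain ⟨j, hj⟩ : ∃ j : ℤ, B ≤ n + j * k := by
      refine ⟨k * |B - n|, ?_⟩
      have h1 : 1 ≤ k * k := by
        have := mul_self_pos.2 hk
        omega
      have h2 := le_abs_self (B - n)
      nlinarith [abs_nonneg (B - n)]
    have hmem : t ^ j * (t⁻¹ * t' ^ ε) * (t ^ j)⁻¹ ∈ U := by
      refine ⟨A.mul_mem (A.mul_mem (A.zpow_mem ht j) (A.mul_mem (A.inv_mem ht)
        (A.zpow_mem ht' ε))) (A.inv_mem (A.zpow_mem ht j)), n₀ + k.natAbs + j * k,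
        fun m hm => ?_⟩
      have e1 : (t ^ j)⁻¹ • f m = f (m - j * k) := by
        rw [inv_smul_eq_iff, zpow_smul_line h]; congr 1; ring
      rw [mul_smul, e1, mul_smul, mul_smul, hmove _ (by omega), ← h, inv_smul_smul,
        zpow_smul_line h]
      congr 1; ring
    have := hUB _ hmem _ hj
    rw [mul_smul] at this
    have e1 : (t ^ j)⁻¹ • f (n + j * k) = f n := by
      rw [inv_smul_eq_iff, zpow_smul_line h]
    rw [e1, mul_smul, ← zpow_smul_line h j n] at this
    exact MulAction.injective _ this
  refine range_line_unique hT hact (t := t' ^ ε) (k := k) (k' := ε * k) hf (fun n => ?_) hk hf'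
    (fun n => zpow_smul_line h' ε n) (mul_ne_zero hε hk)
  have := hd n
  rwa [mul_smul, inv_smul_eq_iff, h] at this

/-- When two points of `f'` project to different points of `f`, the geodesic between them, which
lies in `f'`, runs through both projections. These are then in the bounded intersection. -/
theorem proj_bounded (hT : T.IsTree) {f f' : ℤ → V} (hf : IsLine T f) (hf' : IsLine T f')
    {p : V → ℤ} (hp : ∀ y n, T.dist y (f n) = T.dist y (f (p y)) + (p y - n).natAbs) {M : ℕ}
    (hM : ∀ n, f n ∈ Set.range f' → n.natAbs ≤ M) :
    ∃ M' : ℕ, ∀ n, (p (f' n)).natAbs ≤ M' := by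
  refine ⟨M + (p (f' 0)).natAbs, fun n => ?_⟩
  by_cases hne : p (f' n) = p (f' 0)
  · rw [hne]; omega
  · have hd := hf.dist_of_proj_ne hT hp hne
    have h1 := hp (f' n) (p (f' 0))
    have h2 := hp (f' 0) (p (f' n))
    have := hM _ (hf'.isConvex hT (f' n) ⟨n, rfl⟩ (f' 0) ⟨0, rfl⟩ (f (p (f' n))) (by
      rw [T.dist_comm (u := f (p (f' n))) (v := f' 0), hd,
        T.dist_comm (u := f (p (f' 0)))]
      omega))
    omega

/-- If the axes of two hyperbolic elements have a bounded intersection, then powers generate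
free groups of infinite rank. -/
theorem exists_injective_freeGroup (hT : T.IsTree) (hact : ActsOn G T) {t t' : G}
    {f f' : ℤ → V} {k : ℤ} (hf : IsLine T f) (hf' : IsLine T f') (h : ∀ n, t • f n = f (n + k))
    (h' : ∀ n, t' • f' n = f' (n + k)) (hk : 0 < k) {M : ℕ}
    (hM : ∀ n, f n ∈ Set.range f' → n.natAbs ≤ M) :
    ∃ (N : ℤ) (m : ℤ), Function.Injective
      (FreeGroup.lift fun i : ULift.{u} ℕ => t ^ (i.down * N) * t' ^ m * (t ^ (i.down * N))⁻¹) := by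
  obtain ⟨p, hp⟩ := hf.exists_proj hT
  obtain ⟨p', hp'⟩ := hf'.exists_proj hT
  obtain ⟨B, hB⟩ := proj_bounded hT hf hf' hp hM
  have hM2 : ∃ M2 : ℕ, ∀ n, f' n ∈ Set.range f → n.natAbs ≤ M2 := by
    by_cases hex : ∃ n, f' n ∈ Set.range f
    · obtain ⟨n₁, m₁, hm₁⟩ := hex
      refine ⟨n₁.natAbs + 2 * M, ?_⟩
      rintro n ⟨m, hm⟩
      have a1 := hM m ⟨n, hm.symm⟩
      have a2 := hM m₁ ⟨n₁, hm₁.symm⟩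
      have a3 := hf m m₁
      rw [hm, hm₁, hf'] at a3
      omega
    · exact ⟨0, fun n hn => absurd ⟨n, hn⟩ hex⟩
  obtain ⟨M2, hM2⟩ := hM2
  obtain ⟨B', hB'⟩ := proj_bounded hT hf' hf hp' hM2
  -- If `p' z` is not the projection of any point of `f`, every geodesic from `z` to `f` goes
  -- through `f' (p' z)`, so `z` has the same projection to `f` as that point.
  have hproj : ∀ z, B' < (p' z).natAbs → (p z).natAbs ≤ B := by
    intro z hz
    have hall : ∀ n, T.dist z (f n) = T.dist z (f' (p' z)) + T.dist (f' (p' z)) (f n) := by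
      intro n
      have hd := hf'.dist_of_proj_ne hT hp' (y := z) (y' := f n) (by
        intro e; have := hB' n; rw [← e] at this; omega)
      have h1 := hp' (f n) (p' z)
      rw [T.dist_comm (u := f' (p' z)), h1, hd, T.dist_comm (u := f' (p' (f n)))]
      omega
    have e : p z = p (f' (p' z)) := by
      have a1 := hp z (p (f' (p' z)))
      have a2 := hp (f' (p' z)) (p z)
      have a3 := hall (p z)
      have a4 := hall (p (f' (p' z)))
      omega
    rw [e]; exact hB _
  -- Translating by `N * k` makes windows of radius `B` on `f` disjoint; translating by `m * k`
  -- carries everything not below the window of radius `B'` on `f'` above it.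
  set N : ℤ := 2 * B + 1 with hN
  set m : ℤ := 2 * B' + 1 with hm
  have hmk : 2 * (B' : ℤ) + 1 ≤ m * k := by nlinarith
  have hNk : 2 * (B : ℤ) + 1 ≤ N * k := by nlinarith
  have hpt : ∀ (j : ℤ) y, p (t ^ j • y) = p y + j * k := fun j y =>
    proj_smul hT hact (zpow_smul_line h j) hp y
  have hpt' : ∀ (j : ℤ) y, p' (t' ^ j • y) = p' y + j * k := fun j y =>
    proj_smul hT hact (zpow_smul_line h' j) hp' y
  have hpinv : ∀ (j : ℤ) y, p ((t ^ j)⁻¹ • y) = p y - j * k := fun j y => by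
    rw [← zpow_neg, hpt]; ring
  refine ⟨N, m, ?_⟩
  have hdisj : ∀ i j : ULift.{u} ℕ, i ≠ j → ∀ y, B' < (p' ((t ^ ((i.down : ℤ) * N))⁻¹ • y)).natAbs →
      B' < (p' ((t ^ ((j.down : ℤ) * N))⁻¹ • y)).natAbs → False := by
    intro i j hij y hi hj
    have a1 := hproj _ hi
    have a2 := hproj _ hj
    rw [hpinv] at a1 a2
    have b : (((i.down : ℤ) - j.down) * (N * k)).natAbs ≤ 2 * B := by
      have : ((i.down : ℤ) - j.down) * (N * k) = (p y - j.down * N * k) - (p y - i.down * N * k) := by ring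
      omega
    rw [Int.natAbs_mul] at b
    have c : 1 ≤ ((i.down : ℤ) - j.down).natAbs := by
      have : i.down ≠ j.down := fun e => hij (ULift.down_injective e)
      omega
    have d : 2 * B + 1 ≤ (N * k).natAbs := by omega
    nlinarith
  refine FreeGroup.injective_lift_of_ping_pong
    (fun i : ULift.{u} ℕ => t ^ (i.down * N) * t' ^ m * (t ^ (i.down * N))⁻¹)
    (X := fun i : ULift.{u} ℕ => {y : V | (B' : ℤ) < p' ((t ^ ((i.down : ℤ) * N))⁻¹ • y)})
    (Y := fun i : ULift.{u} ℕ => {y : V | p' ((t ^ ((i.down : ℤ) * N))⁻¹ • y) < -(B' : ℤ)}) ?_ ?_ ?_ ?_ ?_ ?_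
  · intro i
    have hself : p' (f' (B' + 1)) = B' + 1 := by
      have := hp' (f' (B' + 1)) (B' + 1)
      rw [SimpleGraph.dist_self] at this
      omega
    refine ⟨t ^ ((i.down : ℤ) * N) • f' (B' + 1), ?_⟩
    simp only [Set.mem_ofPred_eq, inv_smul_smul, hself]
    omega
  · intro i j hij
    refine Set.disjoint_left.2 fun y hi hj => hdisj i j hij y ?_ ?_ <;>
      simp only [Set.mem_ofPred_eq] at hi hj <;> omega
  · intro i j hij
    refine Set.disjoint_left.2 fun y hi hj => hdisj i j hij y ?_ ?_ <;>
      simp only [Set.mem_ofPred_eq] at hi hj <;> omega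
  · intro i j
    refine Set.disjoint_left.2 fun y hi hj => ?_
    simp only [Set.mem_ofPred_eq] at hi hj
    by_cases hij : i = j
    · subst hij; omega
    · exact hdisj i j hij y (by omega) (by omega)
  · rintro i _ ⟨y, hy, rfl⟩
    simp only [Set.mem_ofPred_eq, Set.mem_compl_iff] at hy ⊢
    rw [mul_smul, mul_smul, inv_smul_smul, hpt']
    omega
  · rintro i _ ⟨y, hy, rfl⟩
    simp only [Set.mem_ofPred_eq, Set.mem_compl_iff] at hy ⊢
    change p' ((t ^ ((i.down : ℤ) * N))⁻¹ •
      ((t ^ ((i.down : ℤ) * N) * t' ^ m * (t ^ ((i.down : ℤ) * N))⁻¹)⁻¹ • y)) < -(B' : ℤ)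
    rw [mul_inv_rev, mul_inv_rev, inv_inv, mul_smul, mul_smul, inv_smul_smul, ← zpow_neg t', hpt']
    have : -m * k = -(m * k) := by ring
    omega

/-- A slender group acting on a tree without inversion fixes a vertex or preserves a line. -/
theorem exists_core (hT : T.IsTree) (hact : ActsOn G T) (hinv : NoInversion G T)
    {A : Subgroup G} (hA : ∀ K ≤ A, K.FG) :
    ∃ K : Set V, K.Nonempty ∧ IsConvex T K ∧ (∀ a ∈ A, ∀ x ∈ K, a • x ∈ K) ∧
      ((∃ v, K = {v}) ∨ ∃ f : ℤ → V, IsLine T f ∧ K = Set.range f) := by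
  by_cases hell : ∀ a ∈ A, ∃ v : V, a • v = v
  · obtain ⟨v, hv⟩ := exists_fixed_of_fg hT hact (hA A le_rfl) hell
    refine ⟨{v}, Set.singleton_nonempty v, ?_, ?_, Or.inl ⟨v, rfl⟩⟩
    · rintro _ rfl _ rfl z hz
      rw [SimpleGraph.dist_self] at hz
      exact (hT.1.dist_eq_zero_iff.1 (by omega))
    · rintro a ha _ rfl
      exact hv a ha
  · push Not at hell
    obtain ⟨t, ht, htv⟩ := hell
    obtain ⟨f, k, hf, hk, h⟩ := exists_line hT hact hinv (t := t)
      fun ⟨v, hv⟩ => htv v hv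
    refine ⟨Set.range f, ⟨f 0, 0, rfl⟩, hf.isConvex hT, ?_, Or.inr ⟨f, hf, rfl⟩⟩
    rintro b hb _ ⟨n, rfl⟩
    have ht' : b * t * b⁻¹ ∈ A := A.mul_mem (A.mul_mem hb ht) (A.inv_mem hb)
    have hf' := hf.smul hT hact b
    have h' := conj_line h b
    suffices Set.range f = Set.range fun n => b • f n by
      rw [this]; exact ⟨n, rfl⟩
    -- The axes of `t` and of its conjugate share an upward ray, share a downward ray, or have
    -- bounded intersection. The first two cases give equality; the last gives a free subgroup of
    -- infinite rank in `A`.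
    by_cases hup : ∃ n₀, ∀ n ≥ n₀, f n ∈ Set.range fun n => b • f n
    · obtain ⟨n₀, hn₀⟩ := hup
      exact range_eq_of_common_ray hT hact hA ht ht' hf hf' h h' hk.ne' hn₀
    have hrange : ∀ f : ℤ → V, (Set.range fun n => f (-n)) = Set.range f := fun f =>
      (Equiv.neg ℤ).surjective.range_comp f
    by_cases hdown : ∃ n₀, ∀ n ≤ n₀, f n ∈ Set.range fun n => b • f n
    · obtain ⟨n₀, hn₀⟩ := hdown
      have := range_eq_of_common_ray hT hact hA ht ht' hf.neg hf'.neg (neg_line h) (neg_line h')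
        (neg_ne_zero.2 hk.ne') (n₀ := -n₀) (fun n hn => by
          rw [hrange fun n => b • f n]; exact hn₀ _ (by omega))
      rwa [hrange, hrange fun n => b • f n] at this
    exfalso
    push Not at hup hdown
    have hconv : ∀ i j l, i ≤ j → j ≤ l → f i ∈ (Set.range fun n => b • f n) →
        f l ∈ (Set.range fun n => b • f n) → f j ∈ Set.range fun n => b • f n := by
      intro i j l hij hjl hi hl
      refine hf'.isConvex hT _ hi _ hl _ ?_
      rw [hf, hf, hf]; omega
    have hbdd : ∃ M : ℕ, ∀ n, f n ∈ (Set.range fun n => b • f n) → n.natAbs ≤ M := by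
      by_cases hex : ∃ n, f n ∈ Set.range fun n => b • f n
      · obtain ⟨n₁, hn₁⟩ := hex
        obtain ⟨u, hu, hu'⟩ := hup n₁
        obtain ⟨d, hd, hd'⟩ := hdown n₁
        refine ⟨u.natAbs + d.natAbs, fun n hn => ?_⟩
        by_contra hc
        rcases (by omega : u ≤ n ∨ n ≤ d) with c | c
        · exact hu' (hconv n₁ u n hu c hn₁ hn)
        · exact hd' (hconv n d n₁ c hd hn hn₁)
      · exact ⟨0, fun n hn => absurd ⟨n, hn⟩ hex⟩
    obtain ⟨M, hM⟩ := hbdd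
    obtain ⟨N, m, hinj⟩ := exists_injective_freeGroup hT hact hf hf' h h' hk hM
    set φ := FreeGroup.lift fun i : ULift.{u} ℕ => t ^ (i.down * N) * (b * t * b⁻¹) ^ m * (t ^ (i.down * N))⁻¹ with hφ
    have hle : φ.range ≤ A := by
      refine FreeGroup.range_lift_le ?_
      rintro _ ⟨i, rfl⟩
      exact A.mul_mem (A.mul_mem (A.zpow_mem ht _) (A.zpow_mem ht' _))
        (A.inv_mem (A.zpow_mem ht _))
    have hfg := hA _ hle
    rw [← Group.fg_iff_subgroup_fg] at hfg
    have e := MonoidHom.ofInjective hinj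
    exact not_fg_freeGroup _ (Group.fg_of_surjective (f := e.symm.toMonoidHom) e.symm.surjective)

end Slender

end BassSerre

namespace BassSerre

/-! ### Relations with finitely many orbits that are robustly connected -/

section Connect

variable {G : Type*} [Group G] {V : Type*} [MulAction G V]

/-- The symmetric `H`-invariant relation generated by a set of pairs. -/
def orbitRel (H : Subgroup G) (P : Set (V × V)) (x y : V) : Prop :=
  ∃ h ∈ H, ∃ q ∈ P, (x = h • q.1 ∧ y = h • q.2) ∨ (y = h • q.1 ∧ x = h • q.2)

theorem orbitRel.mono {H : Subgroup G} {P Q : Set (V × V)} (hPQ : P ⊆ Q) {x y : V}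
    (h : orbitRel H P x y) : orbitRel H Q x y := by
  obtain ⟨g, hg, q, hq, e⟩ := h
  exact ⟨g, hg, q, hPQ hq, e⟩

theorem orbitRel.mono_left {H K : Subgroup G} (hHK : H ≤ K) {P : Set (V × V)} {x y : V}
    (h : orbitRel H P x y) : orbitRel K P x y := by
  obtain ⟨g, hg, q, hq, e⟩ := h
  exact ⟨g, hHK hg, q, hq, e⟩

theorem orbitRel.smul {H : Subgroup G} {P : Set (V × V)} {x y : V} (h : orbitRel H P x y)
    {a : G} (ha : a ∈ H) : orbitRel H P (a • x) (a • y) := by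
  obtain ⟨g, hg, q, hq, e⟩ := h
  refine ⟨a * g, H.mul_mem ha hg, q, hq, ?_⟩
  simp only [mul_smul]
  rcases e with ⟨rfl, rfl⟩ | ⟨rfl, rfl⟩
  · exact Or.inl ⟨rfl, rfl⟩
  · exact Or.inr ⟨rfl, rfl⟩

theorem orbitRel.symm {H : Subgroup G} {P : Set (V × V)} {x y : V} (h : orbitRel H P x y) :
    orbitRel H P y x := by
  obtain ⟨g, hg, q, hq, e⟩ := h
  exact ⟨g, hg, q, hq, e.symm⟩

/-- Reachability by the relation `orbitRel H P` outside of a finite set. -/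
def Linked (H : Subgroup G) (P : Set (V × V)) (Z : Finset V) : V → V → Prop :=
  Relation.ReflTransGen fun x y => orbitRel H P x y ∧ x ∉ Z ∧ y ∉ Z

theorem Linked.mono {H K : Subgroup G} (hHK : H ≤ K) {P Q : Set (V × V)} (hPQ : P ⊆ Q)
    {Z : Finset V} {x y : V} (h : Linked H P Z x y) : Linked K Q Z x y :=
  Relation.ReflTransGen.mono (fun _ _ e => ⟨(e.1.mono hPQ).mono_left hHK, e.2⟩) _ _ h

/-- There is a relation on `X` with finitely many `H`-orbits that stays connected when
at most `k` points are removed. -/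
def KConnected (H : Subgroup G) (X : Set V) (k : ℕ) : Prop :=
  ∃ P : Set (V × V), P.Finite ∧ (∀ q ∈ P, q.1 ∈ X ∧ q.2 ∈ X) ∧
    ∀ Z : Finset V, Z.card ≤ k → ∀ a ∈ X, ∀ b ∈ X, a ∉ Z → b ∉ Z → Linked H P Z a b

/-- `X` is `H`-invariant with finitely many orbits. -/
def IsCofinite (H : Subgroup G) (X : Set V) : Prop :=
  (∀ h ∈ H, ∀ x ∈ X, h • x ∈ X) ∧
    ∃ B : Set V, B.Finite ∧ ∀ x ∈ X, ∃ h ∈ H, ∃ b ∈ B, x = h • b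

/-- As in a Cayley graph: join orbit representatives to each other and to their images under the
generators. -/
theorem kConnected_zero {H : Subgroup G} (hH : H.FG) {X : Set V} (hX : IsCofinite H X) :
    KConnected H X 0 := by
  obtain ⟨s, hs⟩ := hH
  obtain ⟨hinv, B, hB, hcov⟩ := hX
  have hsH : ∀ a ∈ s, a ∈ H := fun a ha => hs ▸ Subgroup.subset_closure ha
  refine ⟨((B ×ˢ B) ∪ ⋃ a ∈ s, (fun b => (b, a • b)) '' B) ∩ X ×ˢ X, ?_, fun q hq => hq.2, ?_⟩
  · exact ((hB.prod hB).union (s.finite_toSet.biUnion fun a _ => hB.image _)).inter_of_left _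
  intro Z hZ a ha b hb _ _
  obtain rfl : Z = ∅ := Finset.card_eq_zero.1 (by omega)
  set P := ((B ×ˢ B) ∪ ⋃ a ∈ s, (fun b => (b, a • b)) '' B) ∩ X ×ˢ X with hP
  have step : ∀ {x y}, orbitRel H P x y → Linked H P ∅ x y := fun h =>
    Relation.ReflTransGen.single ⟨h, by simp, by simp⟩
  have key : ∀ h ∈ H, ∀ c ∈ B, c ∈ X → Linked H P ∅ c (h • c) ∧ Linked H P ∅ (h • c) c := by
    intro h hh c hc hcX
    have gen : ∀ g ∈ H, ∀ d ∈ s, orbitRel H P (g • c) ((g * d) • c) := fun g hg d hd =>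
      ⟨g, hg, (c, d • c), ⟨Or.inr (Set.mem_iUnion₂.2 ⟨d, hd, c, hc, rfl⟩), hcX,
        hinv d (hsH d hd) c hcX⟩, Or.inl ⟨rfl, mul_smul g d c⟩⟩
    rw [← hs] at hh
    induction hh using Subgroup.closure_induction_right with
    | one => rw [one_smul]; exact ⟨.refl, .refl⟩
    | mul_right g hg d hd ih =>
      have := gen g (hs ▸ hg) d hd
      exact ⟨ih.1.trans (step this), (step this.symm).trans ih.2⟩
    | mul_inv_cancel g hg d hd ih =>
      have := gen (g * d⁻¹) (H.mul_mem (hs ▸ hg) (H.inv_mem (hsH d hd))) d hd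
      rw [inv_mul_cancel_right] at this
      exact ⟨ih.1.trans (step this.symm), (step this).trans ih.2⟩
  obtain ⟨h, hh, c, hc, rfl⟩ := hcov a ha
  obtain ⟨h', hh', c', hc', rfl⟩ := hcov b hb
  have hcX : c ∈ X := by simpa using hinv h⁻¹ (H.inv_mem hh) _ ha
  have hcX' : c' ∈ X := by simpa using hinv h'⁻¹ (H.inv_mem hh') _ hb
  refine (key h hh c hc hcX).2.trans (Relation.ReflTransGen.trans (step ?_) (key h' hh' c' hc' hcX').1)
  exact ⟨1, H.one_mem, (c, c'), ⟨Or.inl ⟨hc, hc'⟩, hcX, hcX'⟩, Or.inl ⟨(one_smul _ _).symm, (one_smul _ _).symm⟩⟩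

/-- The points related to `x` and different from `x`. -/
def orbitNbrs (H : Subgroup G) (P : Set (V × V)) (x : V) : Set V :=
  {y | orbitRel H P x y ∧ y ≠ x}

theorem isCofinite_orbitNbrs (H : Subgroup G) {P : Set (V × V)} (hP : P.Finite) (x : V) :
    IsCofinite (H ⊓ MulAction.stabilizer G x) (orbitNbrs H P x) := by
  classical
  refine ⟨?_, ?_⟩
  · rintro h ⟨hh, hx⟩ y ⟨hy, hne⟩
    have hx : h • x = x := hx
    refine ⟨by simpa [hx] using hy.smul hh, fun e => hne ?_⟩
    rw [← hx] at e
    exact MulAction.injective _ e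
  -- One carrier from `a` to `x` is chosen for each `a`, with dummy value 1 if there is none; any
  -- other carrier in `H` differs from it by an element of the stabilizer of `x`.
  · have : ∀ a : V, ∃ g : G, (∃ h ∈ H, h • a = x) → g ∈ H ∧ g • a = x := fun a => by
      by_cases h : ∃ h ∈ H, h • a = x
      · obtain ⟨g, h1, h2⟩ := h; exact ⟨g, fun _ => ⟨h1, h2⟩⟩
      · exact ⟨1, fun h' => absurd h' h⟩
    choose c hc using this
    have main : ∀ h ∈ H, ∀ a b : V, x = h • a →
        ∃ g ∈ H ⊓ MulAction.stabilizer G x, h • b = g • (c a • b) := by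
      rintro h hh a b rfl
      obtain ⟨h1, h2⟩ := hc a ⟨h, hh, rfl⟩
      refine ⟨h * (c a)⁻¹, ⟨H.mul_mem hh (H.inv_mem h1), ?_⟩, ?_⟩
      · change (h * (c a)⁻¹) • (h • a) = h • a
        rw [mul_smul]
        conv_lhs => rw [← h2, inv_smul_smul]
      · rw [← mul_smul, inv_mul_cancel_right]
    refine ⟨(fun q : V × V => c q.1 • q.2) '' P ∪ (fun q : V × V => c q.2 • q.1) '' P,
      (hP.image _).union (hP.image _), ?_⟩
    rintro y ⟨⟨h, hh, q, hq, ⟨e1, e2⟩ | ⟨e1, e2⟩⟩, -⟩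
    · obtain ⟨g, hg, e⟩ := main h hh q.1 q.2 e1
      exact ⟨g, hg, _, Or.inl ⟨q, hq, rfl⟩, e2.trans e⟩
    · obtain ⟨g, hg, e⟩ := main h hh q.2 q.1 e2
      exact ⟨g, hg, _, Or.inr ⟨q, hq, rfl⟩, e1.trans e⟩

/-- Enlarge `P` by a relation, robust against `k` removals, on the `P`-neighbours of one point in
each relevant orbit. When `k + 1` points are removed, single out one of them, `x`: a path avoiding
the others can be rerouted around `x` through its neighbours. -/
theorem kConnected_succ {H : Subgroup G} {X : Set V} {k : ℕ} (hinv : ∀ h ∈ H, ∀ x ∈ X, h • x ∈ X)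
    (hk : KConnected H X k)
    (hstab : ∀ x ∈ X, ∀ Y : Set V, IsCofinite (H ⊓ MulAction.stabilizer G x) Y →
      KConnected (H ⊓ MulAction.stabilizer G x) Y k) : KConnected H X (k + 1) := by
  classical
  obtain ⟨P, hP, hPX, hconn⟩ := hk
  have hrelX : ∀ {x y}, orbitRel H P x y → x ∈ X ∧ y ∈ X := by
    rintro x y ⟨h, hh, q, hq, ⟨rfl, rfl⟩ | ⟨rfl, rfl⟩⟩
    · exact ⟨hinv h hh _ (hPX q hq).1, hinv h hh _ (hPX q hq).2⟩
    · exact ⟨hinv h hh _ (hPX q hq).2, hinv h hh _ (hPX q hq).1⟩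
  have hnb : ∀ x : V, ∃ Q : Set (V × V), x ∈ X → Q.Finite ∧
      (∀ q ∈ Q, q.1 ∈ orbitNbrs H P x ∧ q.2 ∈ orbitNbrs H P x) ∧
      ∀ Z : Finset V, Z.card ≤ k → ∀ a ∈ orbitNbrs H P x, ∀ b ∈ orbitNbrs H P x, a ∉ Z → b ∉ Z →
        Linked (H ⊓ MulAction.stabilizer G x) Q Z a b := by
    intro x
    by_cases hx : x ∈ X
    · obtain ⟨Q, h⟩ := hstab x hx _ (isCofinite_orbitNbrs H hP x)
      exact ⟨Q, fun _ => h⟩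
    · exact ⟨∅, fun h => absurd h hx⟩
  choose Q hQ using hnb
  set R : Set V := Prod.fst '' P ∪ Prod.snd '' P with hR
  have hRX : ∀ x ∈ R, x ∈ X := by
    rintro _ (⟨q, hq, rfl⟩ | ⟨q, hq, rfl⟩)
    · exact (hPX q hq).1
    · exact (hPX q hq).2
  have hRfin : R.Finite := (hP.image _).union (hP.image _)
  set P' := P ∪ ⋃ x ∈ R, Q x with hP'
  have hP'fin : P'.Finite := hP.union (hRfin.biUnion fun x hx => (hQ x (hRX x hx)).1)
  have hQP' : ∀ x ∈ R, Q x ⊆ P' := fun x hx q hq => Or.inr (Set.mem_iUnion₂.2 ⟨x, hx, hq⟩)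
  refine ⟨P', hP'fin, ?_, ?_⟩
  · rintro q (hq | hq)
    · exact hPX q hq
    · obtain ⟨x, hx, hq⟩ := Set.mem_iUnion₂.1 hq
      obtain ⟨h1, h2⟩ := (hQ x (hRX x hx)).2.1 q hq
      exact ⟨(hrelX h1.1).2, (hrelX h2.1).2⟩
  intro Z hZ a ha b hb haZ hbZ
  rcases Z.eq_empty_or_nonempty with rfl | ⟨x, hxZ⟩
  · exact (hconn ∅ (by simp) a ha b hb haZ hbZ).mono le_rfl Set.subset_union_left
  set Z' := Z.erase x with hZ'
  have hZ'card : Z'.card ≤ k := by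
    rw [hZ', Finset.card_erase_of_mem hxZ]; omega
  have hmem : ∀ c, c ∉ Z' → c ≠ x → c ∉ Z := fun c h1 h2 h3 =>
    h1 (Finset.mem_erase.2 ⟨h2, h3⟩)
  have hmem' : ∀ c, c ∉ Z → c ∉ Z' := fun c h1 h2 => h1 (Finset.mem_of_mem_erase h2)
  have hlink : ∀ c y, orbitRel H P x c → c ∉ Z → orbitRel H P x y → y ∉ Z →
      Linked H P' Z c y := by
    intro c y hc hcZ hy hyZ
    have hcx : c ≠ x := fun e => hcZ (e ▸ hxZ)
    have hyx : y ≠ x := fun e => hyZ (e ▸ hxZ)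
    obtain ⟨h, hh, r, hr, hxr⟩ : ∃ h ∈ H, ∃ r ∈ R, x = h • r := by
      obtain ⟨h, hh, q, hq, ⟨e1, e2⟩ | ⟨e1, e2⟩⟩ := hc
      · exact ⟨h, hh, _, Or.inl ⟨q, hq, rfl⟩, e1⟩
      · exact ⟨h, hh, _, Or.inr ⟨q, hq, rfl⟩, e2⟩
    have hback : ∀ z, orbitRel H P x z → z ≠ x → h⁻¹ • z ∈ orbitNbrs H P r := by
      intro z hz hzx
      refine ⟨?_, fun e => hzx (by rw [hxr, ← e, smul_inv_smul])⟩
      have := hz.smul (H.inv_mem hh)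
      rwa [hxr, inv_smul_smul] at this
    have hinvZ : ∀ z, h⁻¹ • z ∈ Z'.image (fun z => h⁻¹ • z) ↔ z ∈ Z' := fun z => by
      simp [Finset.mem_image]
    have := (hQ r (hRX r hr)).2.2 (Z'.image fun z => h⁻¹ • z)
      (Finset.card_image_le.trans hZ'card) _ (hback c hc hcx) _ (hback y hy hyx)
      (by rw [hinvZ]; exact hmem' c hcZ) (by rw [hinvZ]; exact hmem' y hyZ)
    have hlift := Relation.ReflTransGen.lift (p := fun x y => orbitRel H P' x y ∧ x ∉ Z ∧ y ∉ Z)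
      (fun z => h • z) (fun u v (huv : orbitRel _ (Q r) u v ∧ _) => ?_) _ _ this
    · simpa [Linked, Function.onFun] using hlift
    · obtain ⟨h1, h2, h3⟩ := huv
      have hnbr : u ∈ orbitNbrs H P r ∧ v ∈ orbitNbrs H P r := by
        have hst := (isCofinite_orbitNbrs H hP r).1
        obtain ⟨g, hg, q, hq, ⟨rfl, rfl⟩ | ⟨rfl, rfl⟩⟩ := h1
        · exact ⟨hst g hg _ ((hQ r (hRX r hr)).2.1 q hq).1,
            hst g hg _ ((hQ r (hRX r hr)).2.1 q hq).2⟩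
        · exact ⟨hst g hg _ ((hQ r (hRX r hr)).2.1 q hq).2,
            hst g hg _ ((hQ r (hRX r hr)).2.1 q hq).1⟩
      have hout : ∀ z, z ∉ Z'.image (fun z => h⁻¹ • z) → z ∈ orbitNbrs H P r → h • z ∉ Z := by
        intro z hz hzr
        refine hmem _ (fun e => hz ?_) (fun e => hzr.2 ?_)
        · rw [← hinvZ, inv_smul_smul] at e; exact e
        · rw [hxr] at e; exact MulAction.injective _ e
      exact ⟨((h1.mono (hQP' r hr)).mono_left inf_le_left).smul hh, hout u h2 hnbr.1,
        hout v h3 hnbr.2⟩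
  -- Follow the path that may visit `x`. While it stands at `x`, the induction records that all
  -- remaining neighbours of `x` have been reached.
  have claim : ∀ c, Linked H P Z' a c → (c ≠ x → Linked H P' Z a c) ∧
      (c = x → ∀ y, orbitRel H P x y → y ∉ Z → Linked H P' Z a y) := by
    intro c hc
    have hax : a ≠ x := fun e => haZ (e ▸ hxZ)
    induction hc with
    | refl => exact ⟨fun _ => .refl, fun e => absurd e hax⟩
    | @tail c d _ hcd ih =>
      obtain ⟨hr, hcZ, hdZ⟩ := hcd
      by_cases hcx : c = x
      · subst hcx
        by_cases hdx : d = c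
        · subst hdx; exact ih
        · exact ⟨fun _ => ih.2 rfl d hr (hmem d hdZ hdx), fun e => absurd e hdx⟩
      · have hac := ih.1 hcx
        refine ⟨fun hdx => hac.tail ⟨hr.mono Set.subset_union_left, hmem c hcZ hcx,
          hmem d hdZ hdx⟩, ?_⟩
        rintro rfl y hy hyZ
        exact hac.trans (hlink c y hr.symm (hmem c hcZ hcx) hy hyZ)
  exact (claim b (hconn Z' hZ'card a ha b hb (hmem' a haZ) (hmem' b hbZ))).1
    fun e => hbZ (e ▸ hxZ)

/-- The induction passes to stabilizers of points, then of further points, so all subgroups of `H`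
must be finitely generated. -/
theorem kConnected_of_slender (k : ℕ) : ∀ (H : Subgroup G), (∀ K ≤ H, K.FG) → ∀ X : Set V,
    IsCofinite H X → KConnected H X k := by
  induction k with
  | zero => exact fun H hH X hX => kConnected_zero (hH H le_rfl) hX
  | succ k ih =>
    intro H hH X hX
    exact kConnected_succ hX.1 (ih H hH X hX) fun x _ Y hY =>
      ih _ (fun K hK => hH K (hK.trans inf_le_left)) Y hY

/-- A connected relation with finitely many orbits whose point stabilizers are slender can be
enlarged so that it stays connected when `k` points are removed. -/
theorem KConnected.of_zero {H : Subgroup G} {X : Set V} (hinv : ∀ h ∈ H, ∀ x ∈ X, h • x ∈ X)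
    (h0 : KConnected H X 0)
    (hst : ∀ x ∈ X, ∀ K ≤ H ⊓ MulAction.stabilizer G x, K.FG) (k : ℕ) : KConnected H X k := by
  induction k with
  | zero => exact h0
  | succ k ih =>
    exact kConnected_succ hinv ih fun x hx Y hY => kConnected_of_slender k _ (hst x hx) Y hY

end Connect

end BassSerre

namespace BassSerre

/-! ### Minimal actions -/

section GTree

variable {G : Type*} [Group G] {V : Type*} [MulAction G V] {T : SimpleGraph V}

/-- Every orbit meets every half-tree. -/
theorem IsGTree.exists_smul_mem_halfTree (hT : IsGTree G T) {p q : V} (h : T.Adj p q) (x : V) :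
    ∃ g : G, g • x ∈ halfTree T p q := by
  by_contra hc
  push Not at hc
  -- The intersection of all half-trees containing the orbit of `x`. It is an invariant subtree, and
  -- it misses `q` if the orbit stays on the side of `p`.
  set A : Set V := {y | ∀ p' q', T.Adj p' q' → (∀ g : G, g • x ∈ halfTree T p' q') →
    y ∈ halfTree T p' q'} with hA
  have hconv : IsConvex T A := fun a ha b hb z hz p' q' h' hx =>
    isConvex_halfTree hT.isTree h' a (ha p' q' h' hx) b (hb p' q' h' hx) z hz
  have hxA : x ∈ A := fun p' q' _ hx => by simpa using hx 1
  have huniv := hT.minimal A (hconv.connected hT.isTree ⟨x, hxA⟩) (by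
    intro g y hy p' q' h' hx
    have := hy (g⁻¹ • p') (g⁻¹ • q') (hT.smul_adj _ _ _ h') fun k => by
      have := hx (g * k)
      rw [mul_smul] at this
      rw [← smul_mem_halfTree hT.isTree hT.smul_adj g]
      simpa using this
    rw [← smul_mem_halfTree hT.isTree hT.smul_adj g] at this
    simpa using this)
  have hq : q ∈ A := huniv ▸ Set.mem_univ q
  exact left_notMem_halfTree (hq q p h.symm fun g =>
    (mem_halfTree_symm hT.isTree h _).2 (hc g))

/-- A minimal action without inversion has no terminal vertex. -/
theorem IsGTree.exists_adj_ne (hT : IsGTree G T) {u v : V} (h : T.Adj u v) :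
    ∃ x, T.Adj v x ∧ x ≠ u := by
  by_contra hc
  push Not at hc
  -- If `v` is terminal, removing its orbit leaves an invariant convex set. When nothing is left,
  -- `u` is in the orbit too, hence terminal, and the edge is inverted.
  set A : Set V := {y | ∀ g : G, g • v ≠ y} with hA
  by_cases hne : A.Nonempty
  · have hconv : IsConvex T A := by
      rintro x hx y hy z hz g rfl
      have key : ∀ x, x ∈ A → T.dist (g • u) x + 1 = T.dist (g • v) x := by
        intro x hx
        obtain ⟨n, hn, hd⟩ := exists_next hT.isTree (hx g)
        have : g⁻¹ • n = u := hc _ (by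
          have := hT.smul_adj g⁻¹ _ _ hn
          rwa [inv_smul_smul] at this)
        rw [inv_smul_eq_iff] at this
        rwa [← this]
      have h1 := key x hx
      have h2 := key y hy
      have h3 := hT.isTree.1.dist_triangle (u := x) (v := g • u) (w := y)
      rw [T.dist_comm (u := x) (v := g • u)] at h3
      rw [T.dist_comm (u := x) (v := g • v)] at hz
      omega
    have huniv := hT.minimal A (hconv.connected hT.isTree hne) (by
      intro g y hy k hk
      exact hy (g⁻¹ * k) (by rw [mul_smul, hk, inv_smul_smul]))
    have : v ∈ A := huniv ▸ Set.mem_univ v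
    exact this 1 (one_smul _ _)
  · have : u ∉ A := fun hu => hne ⟨u, hu⟩
    simp only [hA, Set.mem_ofPred_eq, not_forall, not_not] at this
    obtain ⟨g, hg⟩ := this
    have h1 := hT.smul_adj g _ _ h
    rw [hg] at h1
    have h2 := hc (g⁻¹ • v) (by
      have := hT.smul_adj g⁻¹ _ _ h
      rwa [← hg, inv_smul_smul] at this)
    rw [inv_smul_eq_iff] at h2
    exact hT.no_inversion g u v h ⟨h2.symm, hg⟩

theorem exists_ray (hleaf : ∀ u v, T.Adj u v → ∃ x, T.Adj v x ∧ x ≠ u) {u v : V}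
    (h : T.Adj u v) :
    ∃ r : ℕ → V, r 0 = u ∧ r 1 = v ∧ (∀ n, T.Adj (r n) (r (n + 1))) ∧ ∀ n, r (n + 2) ≠ r n := by
  choose! next hnext using hleaf
  let d : ℕ → V × V := fun n => (fun e : V × V => (e.2, next e.1 e.2))^[n] (u, v)
  have hd : ∀ n, d (n + 1) = ((d n).2, next (d n).1 (d n).2) := fun n =>
    Function.iterate_succ_apply' _ _ _
  have hadj : ∀ n, T.Adj (d n).1 (d n).2 := by
    intro n
    induction n with
    | zero => exact h
    | succ n ih => rw [hd]; exact (hnext _ _ ih).1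
  have h2 : ∀ n, (d (n + 1)).1 = (d n).2 := fun n => by rw [hd]
  refine ⟨fun n => (d n).1, rfl, h2 0, fun n => ?_, fun n => ?_⟩
  · simp only [h2]; exact hadj n
  · simp only [h2]
    rw [hd]
    exact (hnext _ _ (hadj n)).2

theorem dist_ray (hT : T.IsTree) {r : ℕ → V} (hadj : ∀ n, T.Adj (r n) (r (n + 1)))
    (hne : ∀ n, r (n + 2) ≠ r n) (m k : ℕ) : T.dist (r (m + k)) (r m) = k := by
  have key : ∀ k, T.dist (r (m + k)) (r m) = k ∧ T.dist (r (m + k + 1)) (r m) = k + 1 := by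
    intro k
    induction k with
    | zero => simpa using SimpleGraph.dist_eq_one_iff_adj.2 (hadj m).symm
    | succ k ih =>
      refine ⟨ih.2, ?_⟩
      have := dist_of_turn hT (w := r m) (hadj (m + k)) (hadj (m + k + 1)) (hne _)
        (by rw [ih.1, ih.2])
      rw [← add_assoc, this, ih.2]
  exact (key k).1

/-- Every finite set of vertices can be moved into every half-tree. -/
theorem IsGTree.exists_smul_subset_halfTree (hT : IsGTree G T) {p q : V} (h : T.Adj p q)
    {Φ : Set V} (hΦ : Φ.Finite) : ∃ g : G, ∀ x ∈ Φ, g • x ∈ halfTree T p q := by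
  obtain ⟨R, hR⟩ := (hΦ.image (T.dist p)).bddAbove
  -- Carrying `p` more than `R` steps beyond `q` keeps the ball of radius `R` around its image
  -- inside the half-tree.
  obtain ⟨r, r0, r1, hadj, hne⟩ := exists_ray (fun u v => hT.exists_adj_ne) h
  obtain ⟨g, hg⟩ := hT.exists_smul_mem_halfTree (hadj (R + 1)) p
  refine ⟨g, fun x hx => ?_⟩
  by_contra hc
  have hxR : T.dist p x ≤ R := hR ⟨x, hx, rfl⟩
  have hd := dist_smul hT.isTree hT.smul_adj g p x
  have a1 := dist_ray hT.isTree hadj hne 0 (R + 1)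
  have a2 := dist_ray hT.isTree hadj hne 0 (R + 1 + 1)
  have a3 := dist_ray hT.isTree hadj hne 1 R
  have a4 := dist_ray hT.isTree hadj hne 1 (R + 1)
  rw [zero_add, r0] at a1 a2
  rw [r1, add_comm] at a3 a4
  have hp : p ∉ halfTree T (r (R + 1)) (r (R + 1 + 1)) := by
    rw [notMem_halfTree_iff hT.isTree (hadj _), T.dist_comm, a2, T.dist_comm, a1]
  have hq : q ∉ halfTree T (r (R + 1)) (r (R + 1 + 1)) := by
    rw [notMem_halfTree_iff hT.isTree (hadj _), T.dist_comm, a4, T.dist_comm, a3]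
  have c1 := dist_cross hT.isTree (hadj _) hg hp
  have c2 := dist_cross hT.isTree (hadj _) hg hq
  have hgp : g • p ∈ halfTree T p q := by
    rw [mem_halfTree_iff hT.isTree h]; omega
  have c3 := dist_cross hT.isTree h hgp hc
  omega

/-- A cocompact fundamental set whose translates connect the links of the vertices. -/
theorem IsGTree.exists_fundamental_set (hG : Group.FG G) (hT : IsGTree G T) [Nontrivial V] :
    ∃ F : Set V, F.Finite ∧ IsConvex T F ∧
      (∀ u v, T.Adj u v → ∃ g : G, u ∈ g • F ∧ v ∈ g • F) ∧
      ∀ v x y, T.Adj v x → T.Adj v y → Relation.ReflTransGen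
        (fun a b => T.Adj v a ∧ T.Adj v b ∧ ∃ g : G, v ∈ g • F ∧ a ∈ g • F ∧ b ∈ g • F) x y := by
  classical
  have hT' := hT.isTree
  obtain ⟨s, hs⟩ := Group.fg_def.1 hG
  obtain ⟨v₀, y₀, hne⟩ := exists_pair_ne V
  obtain ⟨x₀, hadj, -⟩ := exists_next hT' hne
  -- For each generator `d`, the set `F` contains the edge `v₀x₀` and its image under `d`, so `g •
  -- F` and `(g * d) • F` share an edge, hence a vertex other than any given `v`.
  obtain ⟨F, hFfin, hF, hsub, hv₀⟩ := exists_finite_convex hT'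
    (P := {x₀} ∪ ⋃ d ∈ s, {d • v₀, d • x₀})
    ((Set.finite_singleton _).union (s.finite_toSet.biUnion fun d _ => Set.toFinite _)) v₀
  have hx₀ : x₀ ∈ F := hsub (Or.inl rfl)
  have hdv : ∀ d ∈ s, d • v₀ ∈ F := fun d hd =>
    hsub (Or.inr (Set.mem_iUnion₂.2 ⟨d, hd, by simp⟩))
  have hdx : ∀ d ∈ s, d • x₀ ∈ F := fun d hd =>
    hsub (Or.inr (Set.mem_iUnion₂.2 ⟨d, hd, by simp⟩))
  have hFg : ∀ g : G, IsConvex T (g • F) := fun g => hF.smul hT' hT.smul_adj g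
  have walk : ∀ P : G → Prop, (∀ g, ∀ d ∈ s, P g ↔ P (g * d)) → ∀ g g', P g → P g' := by
    intro P hP g g' hg
    have : ∀ k ∈ Subgroup.closure (s : Set G), P (g * k) := by
      intro k hk
      induction hk using Subgroup.closure_induction_right with
      | one => rwa [mul_one]
      | mul_right k _ d hd ih => rw [← mul_assoc]; exact (hP _ d hd).1 ih
      | mul_inv_cancel k _ d hd ih =>
        rw [hP _ d hd, mul_assoc, inv_mul_cancel_right]; exact ih
    have := this (g⁻¹ * g') (by rw [hs]; trivial)
    rwa [mul_inv_cancel_left] at this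
  have hcover : ∀ u v, T.Adj u v → ∃ g : G, u ∈ g • F ∧ v ∈ g • F := by
    intro u v huv
    by_contra hc
    push Not at hc
    obtain ⟨g, hg⟩ := hT.exists_smul_mem_halfTree huv v₀
    obtain ⟨g', hg'⟩ := hT.exists_smul_mem_halfTree huv.symm v₀
    rw [mem_halfTree_symm hT' huv] at hg'
    refine hg' (walk (fun g => g • v₀ ∈ halfTree T u v) ?_ g g' hg)
    intro g d hd
    have m1 : g • v₀ ∈ g • F := Set.smul_mem_smul_set hv₀
    have m2 : (g * d) • v₀ ∈ g • F := by
      rw [mul_smul]; exact Set.smul_mem_smul_set (hdv d hd)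
    constructor
    · intro h1
      by_contra h2
      have := (hFg g).edge_mem hT' huv m1 m2 h1 h2
      exact hc g this.1 this.2
    · intro h1
      by_contra h2
      have := (hFg g).edge_mem hT' huv m2 m1 h1 h2
      exact hc g this.1 this.2
  refine ⟨F, hFfin, hF, hcover, ?_⟩
  intro v x y hx hy
  set R := Relation.ReflTransGen
    (fun a b => T.Adj v a ∧ T.Adj v b ∧ ∃ g : G, v ∈ g • F ∧ a ∈ g • F ∧ b ∈ g • F) with hR
  -- Two directions at `v` that point to the same translate of `F` are equal, or that translate
  -- contains `v` and both neighbours by convexity.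
  have coh : ∀ g : G, ∀ y ∈ g • F, ∀ y' ∈ g • F, ∀ n n', T.Adj v n → T.Adj v n' →
      T.dist n y + 1 = T.dist v y → T.dist n' y' + 1 = T.dist v y' → R n n' := by
    intro g y hy y' hy' n n' hn hn' hd hd'
    by_cases hnn : n = n'
    · subst hnn; exact Relation.ReflTransGen.refl
    · have hcon := dist_concat hT' (y := y) (m := v) (w := y') (fun z hz hzy => by
        have : z = n := next_unique hT' hz hn hzy hd
        subst this
        rcases dist_adj_cases hT' y' hz with h | h
        · exact absurd (next_unique hT' hz hn' h hd') hnn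
        · exact h)
      have hv : v ∈ g • F := hFg g y hy y' hy' v hcon.symm
      exact Relation.ReflTransGen.single ⟨hn, hn', g, hv, (hFg g).next_mem hv hy hn hd,
        (hFg g).next_mem hv hy' hn' hd'⟩
  have overlap : ∀ g : G, ∀ d ∈ s, ∃ z, z ∈ g • F ∧ z ∈ (g * d) • F ∧ v ≠ z := by
    intro g d hd
    by_cases h : v = (g * d) • v₀
    · refine ⟨(g * d) • x₀, ?_, Set.smul_mem_smul_set hx₀, ?_⟩
      · rw [mul_smul]; exact Set.smul_mem_smul_set (hdx d hd)
      · rw [h]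
        exact (hT.smul_adj (g * d) _ _ hadj).ne
    · refine ⟨(g * d) • v₀, ?_, Set.smul_mem_smul_set hv₀, h⟩
      rw [mul_smul]; exact Set.smul_mem_smul_set (hdv d hd)
  -- Some direction from `v` towards `g • F` is connected to `x`. By `coh` and `overlap` this
  -- property passes between `g` and `g * d`.
  set good : G → Prop := fun g =>
    ∃ z ∈ g • F, ∃ n, T.Adj v n ∧ T.dist n z + 1 = T.dist v z ∧ R x n with hgood
  have self : ∀ n, T.Adj v n → T.dist n n + 1 = T.dist v n := fun n hn => by
    rw [SimpleGraph.dist_self, SimpleGraph.dist_eq_one_iff_adj.2 hn]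
  have step : ∀ g, ∀ d ∈ s, good g ↔ good (g * d) := by
    intro g d hd
    obtain ⟨z, hz, hz', hvz⟩ := overlap g d hd
    obtain ⟨n, hn, hnz⟩ := exists_next hT' hvz
    constructor
    · rintro ⟨y, hy, m, hm, hmy, hxm⟩
      exact ⟨z, hz', n, hn, hnz, hxm.trans (coh g y hy z hz m n hm hn hmy hnz)⟩
    · rintro ⟨y, hy, m, hm, hmy, hxm⟩
      exact ⟨z, hz, n, hn, hnz, hxm.trans (coh (g * d) y hy z hz' m n hm hn hmy hnz)⟩
  obtain ⟨gx, -, hgx⟩ := hcover v x hx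
  obtain ⟨gy, -, hgy⟩ := hcover v y hy
  obtain ⟨z, hz, n, hn, hnz, hxn⟩ := walk good step gx gy
    ⟨x, hgx, x, hx, self x hx, Relation.ReflTransGen.refl⟩
  exact hxn.trans (coh gy z hz y hgy n y hn hy hnz (self y hy))

theorem IsGTree.kConnected_link_zero (hT : IsGTree G T) {F : Set V} (hF : F.Finite)
    (hlink : ∀ v x y, T.Adj v x → T.Adj v y → Relation.ReflTransGen
        (fun a b => T.Adj v a ∧ T.Adj v b ∧ ∃ g : G, v ∈ g • F ∧ a ∈ g • F ∧ b ∈ g • F) x y)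
    (v : V) : KConnected (MulAction.stabilizer G v) (T.neighborSet v) 0 := by
  have : ∀ a : V, ∃ c : G, (∃ g : G, g • a = v) → c • a = v := fun a => by
    by_cases h : ∃ g : G, g • a = v
    · exact ⟨h.choose, fun _ => h.choose_spec⟩
    · exact ⟨1, fun h' => absurd h' h⟩
  choose c hc using this
  refine ⟨(⋃ a ∈ F, (c a • F) ×ˢ (c a • F)) ∩ T.neighborSet v ×ˢ T.neighborSet v,
    Set.Finite.inter_of_left
      (hF.biUnion fun a _ => (hF.image _).prod (hF.image _)) _, fun q hq => hq.2, ?_⟩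
  intro Z hZ x hx y hy _ _
  obtain rfl : Z = ∅ := Finset.card_eq_zero.1 (by omega)
  refine Relation.ReflTransGen.mono ?_ _ _ (hlink v x y hx hy)
  rintro a b ⟨ha, hb, g, ⟨v', hv', hgv⟩, ⟨a', ha', rfl⟩, ⟨b', hb', rfl⟩⟩
  simp only at hgv ha hb
  have hcv := hc v' ⟨g, hgv⟩
  refine ⟨⟨g * (c v')⁻¹, ?_, (c v' • a', c v' • b'), ⟨Set.mem_iUnion₂.2 ⟨v', hv',
    Set.smul_mem_smul_set ha', Set.smul_mem_smul_set hb'⟩, ?_, ?_⟩, Or.inl ⟨?_, ?_⟩⟩,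
    by simp, by simp⟩
  · rw [MulAction.mem_stabilizer_iff, mul_smul, ← hgv]
    conv_lhs => rw [hgv, ← hcv, inv_smul_smul]
  · have := hT.smul_adj (c v' * g⁻¹) _ _ ha
    rwa [mul_smul, mul_smul, inv_smul_smul, ← hgv, inv_smul_smul, hcv] at this
  · have := hT.smul_adj (c v' * g⁻¹) _ _ hb
    rwa [mul_smul, mul_smul, inv_smul_smul, ← hgv, inv_smul_smul, hcv] at this
  · simp only [mul_smul, inv_smul_smul]
  · simp only [mul_smul, inv_smul_smul]

theorem IsGTree.kConnected_link (hT : IsGTree G T) {F : Set V} (hF : F.Finite)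
    (hlink : ∀ v x y, T.Adj v x → T.Adj v y → Relation.ReflTransGen
        (fun a b => T.Adj v a ∧ T.Adj v b ∧ ∃ g : G, v ∈ g • F ∧ a ∈ g • F ∧ b ∈ g • F) x y)
    (hT' : IsLocallyFinite T ∨ IsSlenderTree G T) (v : V) (k : ℕ) :
    KConnected (MulAction.stabilizer G v) (T.neighborSet v) k := by
  rcases hT' with hfin | hsl
  · refine ⟨T.neighborSet v ×ˢ T.neighborSet v, (hfin v).prod (hfin v), fun q hq => hq, ?_⟩
    intro Z _ a ha b hb haZ hbZ
    exact Relation.ReflTransGen.single ⟨⟨1, Subgroup.one_mem _, (a, b), ⟨ha, hb⟩,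
      Or.inl ⟨(one_smul _ _).symm, (one_smul _ _).symm⟩⟩, haZ, hbZ⟩
  · refine (hT.kConnected_link_zero hF hlink v).of_zero ?_ ?_ k
    · intro h hh x hx
      have := hT.smul_adj h _ _ hx
      rwa [MulAction.mem_stabilizer_iff.1 hh] at this
    · intro x hx K hK
      exact (hsl v x hx).fg_of_le hK

end GTree

end BassSerre

namespace BassSerre

/-! ### Branch vertices and test segments -/

section Branch

variable {G : Type*} [Group G] {V : Type*} [MulAction G V] {T : SimpleGraph V}

/-- A vertex of valence at least 3. -/
def IsBranch (T : SimpleGraph V) (v : V) : Prop :=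
  ∃ a b c, T.Adj v a ∧ T.Adj v b ∧ T.Adj v c ∧ a ≠ b ∧ a ≠ c ∧ b ≠ c

theorem IsBranch.smul (hact : ActsOn G T) {v : V} (h : IsBranch T v) (g : G) :
    IsBranch T (g • v) := by
  obtain ⟨a, b, c, ha, hb, hc, hab, hac, hbc⟩ := h
  exact ⟨g • a, g • b, g • c, hact g _ _ ha, hact g _ _ hb, hact g _ _ hc,
    fun e => hab (MulAction.injective _ e), fun e => hac (MulAction.injective _ e),
    fun e => hbc (MulAction.injective _ e)⟩

theorem isBranch_smul_iff (hact : ActsOn G T) {v : V} (g : G) :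
    IsBranch T (g • v) ↔ IsBranch T v :=
  ⟨fun h => by simpa using h.smul hact g⁻¹, fun h => h.smul hact g⟩

theorem IsGTree.exists_adj (hT : IsGTree G T) [Nontrivial V] (v : V) : ∃ a, T.Adj v a := by
  obtain ⟨w, hw⟩ := exists_ne v
  obtain ⟨a, ha, -⟩ := exists_next hT.isTree hw.symm
  exact ⟨a, ha⟩

theorem IsGTree.exists_pair_of_not_isBranch (hT : IsGTree G T) [Nontrivial V] {v : V}
    (hv : ¬ IsBranch T v) : ∃ a b, a ≠ b ∧ ∀ x, T.Adj v x ↔ x = a ∨ x = b := by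
  obtain ⟨a, ha⟩ := hT.exists_adj v
  obtain ⟨b, hb, hba⟩ := hT.exists_adj_ne ha.symm
  refine ⟨a, b, hba.symm, fun x => ⟨fun hx => ?_, ?_⟩⟩
  · by_contra hc
    push Not at hc
    exact hv ⟨a, b, x, ha, hb, hx, hba.symm, hc.1.symm, hc.2.symm⟩
  · rintro (rfl | rfl) <;> assumption

/-- An element whose only fixed vertex is `v` must exchange the two neighbours. -/
theorem IsGTree.exists_swap (hT : IsGTree G T) [Nontrivial V] {v : V} (hv : ¬ IsBranch T v) :
    ∃ g : G, ∀ x y, T.Adj v x → T.Adj v y → x ≠ y → g • x = y := by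
  obtain ⟨a, b, hab, h⟩ := hT.exists_pair_of_not_isBranch hv
  have hset : T.neighborSet v = {a, b} := by
    ext x; simp [h]
  obtain ⟨g, hg⟩ := hT.no_redundant v (by rw [hset, Set.ncard_pair hab])
  have hgv : g • v = v := (hg v).2 rfl
  have key : ∀ x, T.Adj v x → T.Adj v (g • x) ∧ g • x ≠ x := fun x hx =>
    ⟨by simpa [hgv] using hT.smul_adj g _ _ hx, fun e => hx.ne ((hg x).1 e).symm⟩
  refine ⟨g, fun x y hx hy hxy => ?_⟩
  have h1 := key x hx
  rw [h] at h1 hx hy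
  rcases hx with rfl | rfl <;> rcases hy with rfl | rfl <;> rcases h1.1 with e | e <;>
    first
    | exact e
    | exact absurd rfl hxy
    | exact absurd e h1.2

/-- If two adjacent vertices have valence 2, then the tree is a line. -/
theorem IsGTree.not_isBranch_of_adj (hT : IsGTree G T) [Nontrivial V] {u v : V} (h : T.Adj u v)
    (hu : ¬ IsBranch T u) (hv : ¬ IsBranch T v) (w : V) : ¬ IsBranch T w := by
  suffices ∀ n w, T.dist w u = n → ¬ IsBranch T w ∧ ∃ x, T.Adj w x ∧ ¬ IsBranch T x from
    (this _ w rfl).1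
  intro n
  induction n with
  | zero =>
    intro w hw
    rw [hT.isTree.1.dist_eq_zero_iff.1 hw]
    exact ⟨hu, v, h, hv⟩
  | succ n ih =>
    intro w hw
    have hne : w ≠ u := by rintro rfl; simp at hw
    obtain ⟨z, hz, hzd⟩ := exists_next hT.isTree hne
    obtain ⟨hzb, x, hx, hxb⟩ := ih z (by omega)
    refine ⟨?_, z, hz, hzb⟩
    by_cases hxw : x = w
    · rwa [← hxw]
    · obtain ⟨g, hg⟩ := hT.exists_swap hzb
      rw [← hg x w hx hz.symm hxw, isBranch_smul_iff hT.smul_adj]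
      exact hxb

/-- At most one neighbour of `w₁` is closer to `w₂`. -/
theorem IsBranch.exists_pair_away (hT : T.IsTree) {w₁ : V} (h : IsBranch T w₁)
    (w₂ : V) : ∃ y y', y ≠ y' ∧ T.Adj w₁ y ∧ T.Adj w₁ y' ∧
      T.dist y w₂ = T.dist w₁ w₂ + 1 ∧ T.dist y' w₂ = T.dist w₁ w₂ + 1 := by
  obtain ⟨a, b, c, ha, hb, hc, hab, hac, hbc⟩ := h
  have key : ∀ {x y}, T.Adj w₁ x → T.Adj w₁ y → x ≠ y → T.dist x w₂ + 1 = T.dist w₁ w₂ →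
      T.dist y w₂ = T.dist w₁ w₂ + 1 := by
    intro x y hx hy hxy hd
    rcases dist_adj_cases hT w₂ hy with h | h
    · exact absurd (next_unique hT hx hy hd h) hxy
    · exact h
  rcases dist_adj_cases hT w₂ ha with h1 | h1
  · exact ⟨b, c, hbc, hb, hc, key ha hb hab h1, key ha hc hac h1⟩
  · rcases dist_adj_cases hT w₂ hb with h2 | h2
    · exact ⟨a, c, hac, ha, hc, h1, key hb hc hbc h2⟩
    · exact ⟨a, b, hab, ha, hb, h1, h2⟩

/-- Two outward neighbours at each end suffice to avoid any prescribed `x₁` and `x₂`, which will be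
the neighbours continuing the line `K`. -/
theorem exists_away_pairs (hT : T.IsTree) (w₁ w₂ : V) : ∃ Q : Set (V × V), Q.Finite ∧
    (∀ q ∈ Q, T.dist q.1 q.2 ≤ 4) ∧ (IsBranch T w₁ → IsBranch T w₂ → w₁ ≠ w₂ →
      T.dist w₁ w₂ ≤ 2 → ∀ x₁ x₂, ∃ y₁ y₂, (y₁, y₂) ∈ Q ∧ y₁ ≠ x₁ ∧ y₂ ≠ x₂ ∧ T.Adj w₁ y₁ ∧
        T.Adj w₂ y₂ ∧ T.dist y₁ w₂ = T.dist w₁ w₂ + 1 ∧ T.dist y₂ w₁ = T.dist w₂ w₁ + 1) := by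
  by_cases h : IsBranch T w₁ ∧ IsBranch T w₂ ∧ w₁ ≠ w₂ ∧ T.dist w₁ w₂ ≤ 2
  · obtain ⟨h1, h2, -, hd⟩ := h
    obtain ⟨a, a', haa, ha, ha', had, had'⟩ := h1.exists_pair_away hT w₂
    obtain ⟨b, b', hbb, hb, hb', hbd, hbd'⟩ := h2.exists_pair_away hT w₁
    have hlen : ∀ x y, T.Adj w₁ x → T.Adj w₂ y → T.dist x y ≤ 4 := by
      intro x y hx hy
      have t1 := hT.1.dist_triangle (u := x) (v := w₁) (w := y)
      have t2 := hT.1.dist_triangle (u := w₁) (v := w₂) (w := y)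
      have t3 := SimpleGraph.dist_eq_one_iff_adj.2 hx.symm
      have t4 := SimpleGraph.dist_eq_one_iff_adj.2 hy
      omega
    refine ⟨({a, a'} : Set V) ×ˢ ({b, b'} : Set V), (Set.toFinite _).prod (Set.toFinite _),
      ?_, ?_⟩
    · rintro ⟨x, y⟩ ⟨hx, hy⟩
      refine hlen x y ?_ ?_
      · rcases hx with rfl | rfl <;> assumption
      · rcases hy with rfl | rfl <;> assumption
    · rintro - - - - x₁ x₂
      obtain ⟨y₁, m1, n1, p1, q1⟩ : ∃ y ∈ ({a, a'} : Set V), y ≠ x₁ ∧ T.Adj w₁ y ∧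
          T.dist y w₂ = T.dist w₁ w₂ + 1 := by
        by_cases e : a = x₁
        · exact ⟨a', by simp, fun e' => haa (e.trans e'.symm), ha', had'⟩
        · exact ⟨a, by simp, e, ha, had⟩
      obtain ⟨y₂, m2, n2, p2, q2⟩ : ∃ y ∈ ({b, b'} : Set V), y ≠ x₂ ∧ T.Adj w₂ y ∧
          T.dist y w₁ = T.dist w₂ w₁ + 1 := by
        by_cases e : b = x₂
        · exact ⟨b', by simp, fun e' => hbb (e.trans e'.symm), hb', hbd'⟩
        · exact ⟨b, by simp, e, hb, hbd⟩
      exact ⟨y₁, y₂, ⟨m1, m2⟩, n1, n2, p1, p2, q1, q2⟩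
  · exact ⟨∅, Set.finite_empty, by simp, fun h1 h2 h3 h4 => absurd ⟨h1, h2, h3, h4⟩ h⟩

/-- There are finitely many segments of length at most 4 whose translates connect the links of
the vertices robustly, and connect the branches at consecutive branch vertices. -/
theorem IsGTree.exists_test_pairs (hG : Group.FG G) (hT : IsGTree G T) [Nontrivial V]
    (hT' : IsLocallyFinite T ∨ IsSlenderTree G T) :
    ∃ P : Set (V × V), P.Finite ∧ (∀ q ∈ P, T.dist q.1 q.2 ≤ 4) ∧
      (∀ (v : V) (Z : Finset V), Z.card ≤ 2 → ∀ x y, T.Adj v x → T.Adj v y → x ∉ Z → y ∉ Z →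
        Relation.ReflTransGen (fun a b => T.Adj v a ∧ T.Adj v b ∧ a ∉ Z ∧ b ∉ Z ∧
          orbitRel (⊤ : Subgroup G) P a b) x y) ∧
      ∀ w₁ w₂, IsBranch T w₁ → IsBranch T w₂ →
        (T.Adj w₁ w₂ ∨ w₁ ≠ w₂ ∧ ∃ u, ¬ IsBranch T u ∧ T.Adj u w₁ ∧ T.Adj u w₂) →
        ∀ x₁ x₂, ∃ y₁ y₂, orbitRel (⊤ : Subgroup G) P y₁ y₂ ∧ y₁ ≠ x₁ ∧ y₂ ≠ x₂ ∧
          T.Adj w₁ y₁ ∧ T.Adj w₂ y₂ ∧ T.dist y₁ w₂ = T.dist w₁ w₂ + 1 ∧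
          T.dist y₂ w₁ = T.dist w₂ w₁ + 1 := by
  classical
  have hTt := hT.isTree
  obtain ⟨F, hF, -, hcover, hlink⟩ := hT.exists_fundamental_set hG
  have hcov : ∀ v, ∃ g : G, ∃ v₀ ∈ F, g • v₀ = v := fun v => by
    obtain ⟨a, ha⟩ := hT.exists_adj v
    obtain ⟨g, ⟨v₀, hv₀, e⟩, -⟩ := hcover v a ha
    exact ⟨g, v₀, hv₀, e⟩
  choose L hLfin hLmem hL using fun v => hT.kConnected_link hF hlink hT' v 2
  choose Q hQfin hQlen hQ using fun w₁ w₂ : V => exists_away_pairs hTt w₁ w₂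
  -- Up to translation, `D` contains all adjacent pairs and all pairs of neighbours of a vertex of
  -- valence 2.
  set D : Set (V × V) :=
    F ×ˢ F ∪ ⋃ u ∈ {u ∈ F | ¬ IsBranch T u}, T.neighborSet u ×ˢ T.neighborSet u with hD
  have hDfin : D.Finite := by
    refine (hF.prod hF).union ((hF.subset fun u hu => hu.1).biUnion fun u hu => ?_)
    obtain ⟨a, b, -, hab⟩ := hT.exists_pair_of_not_isBranch hu.2
    have : (T.neighborSet u).Finite :=
      (Set.toFinite {a, b}).subset fun x hx => (hab x).1 hx
    exact this.prod this
  refine ⟨(⋃ v ∈ F, L v) ∪ ⋃ d ∈ D, Q d.1 d.2,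
    (hF.biUnion fun v _ => hLfin v).union (hDfin.biUnion fun d _ => hQfin _ _), ?_, ?_, ?_⟩
  · rintro q (hq | hq)
    · obtain ⟨v, -, hq⟩ := Set.mem_iUnion₂.1 hq
      obtain ⟨h1, h2⟩ := hLmem v q hq
      have t1 := hTt.1.dist_triangle (u := q.1) (v := v) (w := q.2)
      have t3 := SimpleGraph.dist_eq_one_iff_adj.2 (SimpleGraph.Adj.symm h1)
      have t4 := SimpleGraph.dist_eq_one_iff_adj.2 h2
      omega
    · obtain ⟨d, -, hq⟩ := Set.mem_iUnion₂.1 hq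
      exact hQlen _ _ q hq
  · intro v Z hZ x y hx hy hxZ hyZ
    obtain ⟨g, v₀, hv₀, rfl⟩ := hcov v
    have hadj : ∀ z, T.Adj (g • v₀) z ↔ T.Adj v₀ (g⁻¹ • z) := fun z => by
      rw [← adj_smul hT.smul_adj g (u := v₀), smul_inv_smul]
    have himg : ∀ z, g⁻¹ • z ∈ Z.image (fun z => g⁻¹ • z) ↔ z ∈ Z := fun z => by
      simp [Finset.mem_image]
    have hlk := hL v₀ (Z.image fun z => g⁻¹ • z) (Finset.card_image_le.trans hZ) (g⁻¹ • x)
      ((hadj x).1 hx) (g⁻¹ • y) ((hadj y).1 hy) (by rwa [himg]) (by rwa [himg])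
    have hres := Relation.ReflTransGen.lift
      (p := fun a b => T.Adj (g • v₀) a ∧ T.Adj (g • v₀) b ∧ a ∉ Z ∧ b ∉ Z ∧
        orbitRel (⊤ : Subgroup G) ((⋃ v ∈ F, L v) ∪ ⋃ d ∈ D, Q d.1 d.2) a b)
      (fun z => g • z)
      (fun a b (hab : orbitRel (MulAction.stabilizer G v₀) (L v₀) a b ∧ _) => ?_) _ _ hlk
    · simpa [Function.onFun] using hres
    · obtain ⟨h1, h2, h3⟩ := hab
      have hnbr : T.Adj v₀ a ∧ T.Adj v₀ b := by
        have hst : ∀ k ∈ MulAction.stabilizer G v₀, ∀ z, T.Adj v₀ z → T.Adj v₀ (k • z) := by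
          intro k hk z hz
          have := hT.smul_adj k _ _ hz
          rwa [MulAction.mem_stabilizer_iff.1 hk] at this
        obtain ⟨k, hk, q, hq, ⟨rfl, rfl⟩ | ⟨rfl, rfl⟩⟩ := h1
        · exact ⟨hst k hk _ (hLmem v₀ q hq).1, hst k hk _ (hLmem v₀ q hq).2⟩
        · exact ⟨hst k hk _ (hLmem v₀ q hq).2, hst k hk _ (hLmem v₀ q hq).1⟩
      refine ⟨hT.smul_adj g _ _ hnbr.1, hT.smul_adj g _ _ hnbr.2, ?_, ?_, ?_⟩
      · rw [← himg, inv_smul_smul]; exact h2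
      · rw [← himg, inv_smul_smul]; exact h3
      · have hsub : L v₀ ⊆ (⋃ v ∈ F, L v) ∪ ⋃ d ∈ D, Q d.1 d.2 := fun q hq =>
          Or.inl (Set.mem_iUnion₂.2 ⟨v₀, hv₀, hq⟩)
        exact ((h1.mono hsub).mono_left le_top).smul (Subgroup.mem_top g)
  · intro w₁ w₂ hw₁ hw₂ hrel x₁ x₂
    obtain ⟨g, d, hd, rfl, rfl⟩ : ∃ g : G, ∃ d ∈ D, g • d.1 = w₁ ∧ g • d.2 = w₂ := by
      rcases hrel with h | ⟨-, u, hu, h1, h2⟩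
      · obtain ⟨g, ⟨a, ha, e1⟩, ⟨b, hb, e2⟩⟩ := hcover _ _ h
        exact ⟨g, (a, b), Or.inl ⟨ha, hb⟩, e1, e2⟩
      · obtain ⟨g, u₀, hu₀, rfl⟩ := hcov u
        refine ⟨g, (g⁻¹ • w₁, g⁻¹ • w₂), Or.inr (Set.mem_iUnion₂.2 ⟨u₀, ⟨hu₀, ?_⟩, ?_, ?_⟩),
          smul_inv_smul _ _, smul_inv_smul _ _⟩
        · rwa [isBranch_smul_iff hT.smul_adj] at hu
        · have := hT.smul_adj g⁻¹ _ _ h1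
          rwa [inv_smul_smul] at this
        · have := hT.smul_adj g⁻¹ _ _ h2
          rwa [inv_smul_smul] at this
    have hne : g • d.1 ≠ g • d.2 := by
      rcases hrel with h | ⟨h, -⟩
      · exact h.ne
      · exact h
    have hd2 : T.dist (g • d.1) (g • d.2) ≤ 2 := by
      rcases hrel with h | ⟨-, u, -, h1, h2⟩
      · rw [SimpleGraph.dist_eq_one_iff_adj.2 h]; omega
      · have t1 := hTt.1.dist_triangle (u := g • d.1) (v := u) (w := g • d.2)
        have t3 := SimpleGraph.dist_eq_one_iff_adj.2 h1.symm
        have t4 := SimpleGraph.dist_eq_one_iff_adj.2 h2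
        omega
    rw [isBranch_smul_iff hT.smul_adj] at hw₁ hw₂
    rw [dist_smul hTt hT.smul_adj] at hd2
    obtain ⟨y₁, y₂, hy, n1, n2, a1, a2, d1, d2⟩ := hQ d.1 d.2 hw₁ hw₂
      (fun e => hne (by rw [e])) hd2 (g⁻¹ • x₁) (g⁻¹ • x₂)
    refine ⟨g • y₁, g • y₂, ⟨g, Subgroup.mem_top g, (y₁, y₂),
      Or.inr (Set.mem_iUnion₂.2 ⟨d, hd, hy⟩), Or.inl ⟨rfl, rfl⟩⟩, ?_, ?_,
      hT.smul_adj g _ _ a1, hT.smul_adj g _ _ a2, ?_, ?_⟩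
    · intro e; exact n1 (by rw [← e, inv_smul_smul])
    · intro e; exact n2 (by rw [← e, inv_smul_smul])
    · simpa only [dist_smul hTt hT.smul_adj] using d1
    · simpa only [dist_smul hTt hT.smul_adj] using d2

end Branch

end BassSerre

namespace BassSerre

/-! ### Trees that are lines -/

section LineCase

variable {G : Type*} [Group G] {V : Type*} [MulAction G V] {S : SimpleGraph V}
variable {W : Type*} [MulAction G W] {T : SimpleGraph W}

theorem IsGTree.exists_far_smul (hT : IsGTree G T) [Nontrivial W] (x : W) (B : ℕ) :
    ∃ g : G, B < T.dist (g • x) x := by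
  obtain ⟨y, hy⟩ := hT.exists_adj x
  obtain ⟨r, r0, -, hadj, hne⟩ := exists_ray (fun u v => hT.exists_adj_ne) hy
  obtain ⟨g, hg⟩ := hT.exists_smul_mem_halfTree (hadj B) x
  have a1 := dist_ray hT.isTree hadj hne 0 B
  have a2 := dist_ray hT.isTree hadj hne 0 (B + 1)
  rw [zero_add, r0] at a1 a2
  have hx : x ∉ halfTree T (r B) (r (B + 1)) := by
    rw [notMem_halfTree_iff hT.isTree (hadj _), T.dist_comm, a2, T.dist_comm, a1]
  have := dist_cross hT.isTree (hadj _) hg hx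
  exact ⟨g, by omega⟩

/-- In a connected graph, a property that passes to adjacent vertices holds everywhere. -/
theorem forall_of_adj (hS : S.IsTree) {Q : V → Prop} {u : V} (hu : Q u)
    (hstep : ∀ a b, S.Adj a b → Q a → Q b) (w : V) : Q w := by
  induction hn : S.dist w u generalizing w with
  | zero => rwa [hS.1.dist_eq_zero_iff.1 hn]
  | succ n ih =>
    have hne : w ≠ u := by rintro rfl; simp at hn
    obtain ⟨z, hz, hd⟩ := exists_next hS hne
    exact hstep z w hz.symm (ih z (by omega))

theorem IsGTree.fixes_of_line (hS : IsGTree G S) [Nontrivial V] (hline : ∀ v, ¬ IsBranch S v)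
    {u v : V} (h : S.Adj u v) {a : G} (hu : a • u = u) (hv : a • v = v) (w : V) : a • w = w := by
  have key : ∀ {w x}, S.Adj w x → a • w = w → a • x = x → ∀ y, S.Adj w y → a • y = y := by
    intro w x hx hw hax y hy
    by_cases hxy : x = y
    · rwa [← hxy]
    · obtain ⟨p, q, -, hpq⟩ := hS.exists_pair_of_not_isBranch (hline w)
      have h1 := hS.smul_adj a _ _ hy
      rw [hw, hpq] at h1
      have h2 : a • y ≠ x := fun e => hxy (MulAction.injective a (hax.trans e.symm))
      rw [hpq] at hx hy
      rcases hx with rfl | rfl <;> rcases hy with rfl | rfl <;> rcases h1 with e | e <;>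
        first
        | exact e
        | exact absurd rfl hxy
        | exact absurd e h2
  refine (forall_of_adj hS.isTree (Q := fun w => a • w = w ∧ ∀ y, S.Adj w y → a • y = y)
    ⟨hu, key h hu hv⟩ ?_ w).1
  rintro c d hcd ⟨hc, hcn⟩
  exact ⟨hcn d hcd, key hcd.symm (hcn d hcd) hc⟩

/-- On a line, the stabilizer of an edge is the kernel of the action, and the powers of `h` have
finitely many cosets modulo it. The kernel acts trivially on `T`, so if `h` fixed `p₀` the orbit of
`p₀` would be bounded, against minimality. -/
theorem IsGTree.not_elliptic_of_line (hS : IsGTree G S) [Nontrivial V]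
    (hline : ∀ v, ¬ IsBranch S v) (hT : IsGTree G T) [Nontrivial W]
    (hell : IsEllipticWithRespectTo G S W) {h : G} (hh : IsHyperbolic h V) :
    IsHyperbolic h W := by
  classical
  rintro ⟨p₀, hp₀⟩
  obtain ⟨f, k, hf, hk, hfk⟩ := exists_line hS.isTree hS.smul_adj hS.no_inversion hh
  obtain ⟨x₀, hx₀⟩ := hell _ _ (hf.adj 0)
  have hfix : ∀ n ∈ edgeStabilizer G (f 0) (f (0 + 1)), ∀ w : V, n • w = w := fun n hn w =>
    hS.fixes_of_line hline (hf.adj 0) hn.1 hn.2 w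
  have htriv : ∀ n ∈ edgeStabilizer G (f 0) (f (0 + 1)), ∀ x : W, n • x = x := by
    -- The fixed set of a normal subgroup is invariant; it is non-empty by relative ellipticity, so
    -- minimality makes it all of `T`.
    set A : Set W := {x | ∀ n ∈ edgeStabilizer G (f 0) (f (0 + 1)), n • x = x} with hA
    have hconv : IsConvex T A := fun x hx y hy z hz n hn =>
      isConvex_fixedBy hT.isTree hT.smul_adj n x (hx n hn) y (hy n hn) z hz
    have huniv := hT.minimal A (hconv.connected hT.isTree ⟨x₀, hx₀⟩) (by
      intro g x hx n hn
      have hc : ∀ w : V, (g⁻¹ * n * g) • w = w := fun w => by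
        rw [mul_smul, mul_smul, hfix n hn, inv_smul_smul]
      have := hx (g⁻¹ * n * g) ⟨hc _, hc _⟩
      rwa [mul_smul, mul_smul, inv_smul_eq_iff] at this)
    intro n hn x
    have : x ∈ A := huniv ▸ Set.mem_univ x
    exact this n hn
  have hsurj : ∀ w, w ∈ Set.range f := by
    refine forall_of_adj hS.isTree (u := f 0) ⟨0, rfl⟩ ?_
    rintro _ b hb ⟨n, rfl⟩
    by_contra hc
    refine hline (f n) ⟨f (n + 1), f (n - 1), b, hf.adj n, (hf.adj_iff _ _).2 (Or.inr rfl), hb,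
      fun e => ?_, fun e => hc ⟨_, e⟩, fun e => hc ⟨_, e⟩⟩
    have := hf.injective e
    omega
  have hrep : ∀ e : V × V, ∃ c : G, (∃ g : G, g • f 0 = e.1 ∧ g • f (0 + 1) = e.2) →
      c • f 0 = e.1 ∧ c • f (0 + 1) = e.2 := fun e => by
    by_cases h : ∃ g : G, g • f 0 = e.1 ∧ g • f (0 + 1) = e.2
    · exact ⟨h.choose, fun _ => h.choose_spec⟩
    · exact ⟨1, fun h' => absurd h' h⟩
  choose c hc using hrep
  -- A power of `h` moves the origin of any translate of the edge into one period; the other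
  -- endpoint may stick out by 1.
  set D : Set (V × V) := (f '' Set.Icc 0 k) ×ˢ (f '' Set.Icc (-1) (k + 1)) with hD
  have hDfin : D.Finite := ((Set.finite_Icc _ _).image _).prod ((Set.finite_Icc _ _).image _)
  obtain ⟨B, hB⟩ := (hDfin.image fun e => T.dist (c e • p₀) p₀).bddAbove
  obtain ⟨g, hg⟩ := hT.exists_far_smul p₀ B
  obtain ⟨i, hi⟩ := hsurj (g • f 0)
  obtain ⟨i', hi'⟩ := hsurj (g • f (0 + 1))
  have hii : i' = i + 1 ∨ i' = i - 1 := by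
    rw [← hf.adj_iff, hi, hi', adj_smul hS.smul_adj]
    exact hf.adj 0
  set j := i / k with hj
  have h0 := Int.emod_nonneg i hk.ne'
  have h1 := Int.emod_lt_of_pos i hk
  have h2 : j * k + i % k = i := Int.ediv_mul_add_emod i k
  set r := i % k with hr
  have e1 : (h ^ (-j) * g) • f 0 = f r := by
    rw [mul_smul, ← hi, zpow_smul_line hfk]
    congr 1
    linarith
  have e2 : (h ^ (-j) * g) • f (0 + 1) = f (i' - j * k) := by
    rw [mul_smul, ← hi', zpow_smul_line hfk]
    congr 1
    ring
  obtain ⟨c1, c2⟩ := hc (f r, f (i' - j * k)) ⟨_, e1, e2⟩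
  simp only at c1 c2
  have hmem : (f r, f (i' - j * k)) ∈ D :=
    ⟨⟨r, ⟨h0, h1.le⟩, rfl⟩, ⟨i' - j * k, ⟨by omega, by omega⟩, rfl⟩⟩
  have hb : T.dist (c (f r, f (i' - j * k)) • p₀) p₀ ≤ B := hB ⟨_, hmem, rfl⟩
  have hn : ((c (f r, f (i' - j * k)))⁻¹ * (h ^ (-j) * g)) • p₀ = p₀ :=
    htriv _ ⟨by
      change _ • f 0 = f 0
      rw [mul_smul, e1, inv_smul_eq_iff, c1], by
      change _ • f (0 + 1) = f (0 + 1)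
      rw [mul_smul, e2, inv_smul_eq_iff, c2]⟩ p₀
  rw [mul_smul, inv_smul_eq_iff] at hn
  have hz : h ^ (-j) • p₀ = p₀ := by
    have : h ∈ MulAction.stabilizer G p₀ := hp₀
    exact (MulAction.stabilizer G p₀).zpow_mem this (-j)
  rw [← hn] at hb
  have := dist_smul hT.isTree hT.smul_adj (h ^ (-j)) (g • p₀) p₀
  rw [hz, ← mul_smul] at this
  omega

end LineCase

/-! ### Ingredients of the main argument -/

section Ingredients

variable {G : Type*} [Group G] {V : Type*} [MulAction G V] {S : SimpleGraph V}
variable {W : Type*} [MulAction G W] {T : SimpleGraph W}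

/-- If `S` is elliptic with respect to a tree, the edges of `S` can be mapped equivariantly to
vertices of that tree. -/
theorem exists_equivariant (hact : ActsOn G S) [Nonempty W]
    (hell : IsEllipticWithRespectTo G S W) :
    ∃ f : V → V → W, ∀ (g : G) (u v : V), S.Adj u v → f (g • u) (g • v) = g • f u v := by
  classical
  have hφ : ∀ e : V × V, ∃ x : W, S.Adj e.1 e.2 → ∀ g ∈ edgeStabilizer G e.1 e.2, g • x = x := by
    intro e
    by_cases h : S.Adj e.1 e.2
    · obtain ⟨x, hx⟩ := hell _ _ h
      exact ⟨x, fun _ => hx⟩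
    · exact ⟨Classical.arbitrary W, fun h' => absurd h' h⟩
  choose φ hφ using hφ
  -- Choose a fixed point for one oriented edge per orbit and transport it; different transporters
  -- agree since they differ by the edge stabilizer.
  let r : V × V → V × V := fun e => (Quotient.mk (MulAction.orbitRel G (V × V)) e).out
  have hr : ∀ e, ∃ g : G, g • r e = e := fun e => by
    have : (MulAction.orbitRel G (V × V)).r (r e) e := Quotient.exact (Quotient.out_eq _)
    obtain ⟨g, hg⟩ := this
    exact ⟨g⁻¹, by rw [inv_smul_eq_iff]; exact hg.symm⟩
  choose γ hγ using hr
  have hrg : ∀ (g : G) e, r (g • e) = r e := fun g e => by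
    have : Quotient.mk (MulAction.orbitRel G (V × V)) (g • e) = Quotient.mk _ e :=
      Quotient.sound ⟨g, rfl⟩
    simp only [r, this]
  refine ⟨fun u v => γ (u, v) • φ (r (u, v)), fun g u v huv => ?_⟩
  have hadj : S.Adj (r (u, v)).1 (r (u, v)).2 := by
    rw [← adj_smul hact (γ (u, v))]
    have := hγ (u, v)
    rw [← Prod.smul_fst, ← Prod.smul_snd, this]
    exact huv
  have h1 := hγ (g • (u, v))
  rw [hrg] at h1
  have h2 : ((g * γ (u, v))⁻¹ * γ (g • (u, v))) • r (u, v) = r (u, v) := by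
    rw [mul_smul, h1, inv_smul_eq_iff, mul_smul, hγ]
  have h3 := hφ _ hadj ((g * γ (u, v))⁻¹ * γ (g • (u, v)))
    ⟨congrArg Prod.fst h2, congrArg Prod.snd h2⟩
  rw [mul_smul, inv_smul_eq_iff, mul_smul] at h3
  change γ (g • (u, v)) • φ (r (g • (u, v))) = g • γ (u, v) • φ (r (u, v))
  rw [hrg]
  exact h3

/-- The geodesics from `p₀` to `y` and to `t • y` both cross `pq`, at the same distance from `p₀`,
and `t` maps one to the other. -/
theorem fixes_edge_of_cross (hT : T.IsTree) (hact : ActsOn G T) {p q : W} (hpq : T.Adj p q)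
    {t : G} {p₀ y : W} (hp₀ : t • p₀ = p₀) (h0 : p₀ ∈ halfTree T p q) (hy : y ∉ halfTree T p q)
    (hty : t • y ∉ halfTree T p q) : t • p = p ∧ t • q = q := by
  have c1 := dist_cross hT hpq h0 hy
  have c2 := dist_cross hT hpq h0 hty
  have d0 := dist_smul hT hact t p₀ y
  have d1 := dist_smul hT hact t p₀ p
  have d2 := dist_smul hT hact t p₀ q
  have d3 := dist_smul hT hact t p y
  have d4 := dist_smul hT hact t q y
  rw [hp₀] at d0 d1 d2
  rw [mem_halfTree_iff hT hpq] at h0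
  rw [notMem_halfTree_iff hT hpq, T.dist_comm, T.dist_comm (v := p)] at hy hty
  exact ⟨eq_of_dist_eq hT (x := p₀) (y := t • y) (by omega) (by omega) d1,
    eq_of_dist_eq hT (x := p₀) (y := t • y) (by omega) (by omega) d2⟩

/-- If `t` fixes `p₀` and no power of `t` fixes an edge, then the points `t ^ j • x` are on the
same side of the edge as `p₀` for arbitrarily large `j`. -/
theorem exists_large_power (hT : T.IsTree) (hact : ActsOn G T) {p q : W} (hpq : T.Adj p q)
    {t : G} {p₀ : W} (hp₀ : t • p₀ = p₀)
    (hpow : ∀ n : ℤ, n ≠ 0 → ¬ (t ^ n • p = p ∧ t ^ n • q = q)) (x : W) {k : ℤ} (hk : k ≠ 0)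
    (B : ℤ) : ∃ j : ℤ, B ≤ j * k ∧ (t ^ j • x ∈ halfTree T p q ↔ p₀ ∈ halfTree T p q) := by
  have hz : ∀ n : ℤ, t ^ n • p₀ = p₀ := fun n =>
    (MulAction.stabilizer G p₀).zpow_mem (show t ∈ MulAction.stabilizer G p₀ from hp₀) n
  have two : ∀ i j : ℤ, i ≠ j → (t ^ i • x ∈ halfTree T p q ↔ p₀ ∈ halfTree T p q) ∨
      (t ^ j • x ∈ halfTree T p q ↔ p₀ ∈ halfTree T p q) := by
    intro i j hij
    by_contra hc
    push Not at hc
    have e : t ^ i • x = t ^ (i - j) • (t ^ j • x) := by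
      rw [← mul_smul, ← zpow_add, sub_add_cancel]
    by_cases h0 : p₀ ∈ halfTree T p q
    · refine hpow (i - j) (sub_ne_zero.2 hij) (fixes_edge_of_cross hT hact hpq (hz _) h0
        (y := t ^ j • x) (by tauto) ?_)
      rw [← e]; tauto
    · have := fixes_edge_of_cross hT hact hpq.symm (hz (i - j))
        ((mem_halfTree_symm hT hpq _).2 h0) (y := t ^ j • x)
        (by rw [mem_halfTree_symm hT hpq]; tauto)
        (by rw [← e, mem_halfTree_symm hT hpq]; tauto)
      exact hpow (i - j) (sub_ne_zero.2 hij) this.symm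
  have hkk : 1 ≤ k * k := by
    have := mul_self_pos.2 hk
    omega
  -- At most one exponent can fail, so two candidates suffice; the factor `k` makes `j * k`
  -- non-negative whatever the sign of `k`.
  rcases two (k * |B|) (k * (|B| + 1)) (by
    intro e
    have := mul_left_cancel₀ hk e
    omega) with h | h
  · exact ⟨_, by nlinarith [le_abs_self B, abs_nonneg B], h⟩
  · exact ⟨_, by nlinarith [le_abs_self B, abs_nonneg B], h⟩

/-- The distance to a convex set. -/
theorem exists_coreDist (hS : S.IsTree) (hact : ActsOn G S) {K : Set V} (hK : IsConvex S K)
    (hne : K.Nonempty) : ∃ d : V → ℕ, (∀ v, d v = 0 ↔ v ∈ K) ∧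
      (∀ g : G, (∀ x ∈ K, g • x ∈ K) → (∀ x ∈ K, g⁻¹ • x ∈ K) → ∀ v, d (g • v) = d v) ∧
      (∀ a b c, S.Adj a b → S.Adj b c → c ≠ a → d b = d a + 1 → d c = d b + 1) ∧
      (∀ v, v ∉ K → ∃ u, S.Adj u v ∧ d v = d u + 1) ∧
      (∀ v y, v ∈ K → S.Adj v y → y ∉ K → d y = d v + 1) := by
  choose π hπ hgate using hK.exists_gate hS hne
  have hle : ∀ v, ∀ k ∈ K, S.dist v (π v) ≤ S.dist v k := fun v k hk => by
    have := hgate v k hk; omega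
  have hzero : ∀ v, S.dist v (π v) = 0 ↔ v ∈ K := fun v => by
    constructor
    · intro h
      rw [hS.1.dist_eq_zero_iff.1 h]; exact hπ v
    · intro h
      have := hle v v h
      rw [SimpleGraph.dist_self] at this
      omega
  refine ⟨fun v => S.dist v (π v), hzero, ?_, ?_, ?_, ?_⟩
  · intro g hg hg' v
    have h1 := hle (g • v) (g • π v) (hg _ (hπ v))
    have h2 := hle v (g⁻¹ • π (g • v)) (hg' _ (hπ _))
    rw [dist_smul hS hact] at h1
    have h3 := dist_smul hS hact g v (g⁻¹ • π (g • v))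
    rw [smul_inv_smul] at h3
    simp only
    omega
  · intro a b c hab hbc hca hd
    simp only at hd ⊢
    have t1 := hS.1.dist_triangle (u := b) (v := a) (w := π a)
    have t2 := SimpleGraph.dist_eq_one_iff_adj.2 hab.symm
    have g1 := hgate b (π a) (hπ a)
    have e : π b = π a := hS.1.dist_eq_zero_iff.1 (by omega)
    have g2 := hgate b (π c) (hπ c)
    have t3 := hS.1.dist_triangle (u := a) (v := π a) (w := π c)
    have t4 := hS.1.dist_triangle (u := b) (v := a) (w := π c)
    rw [e] at g2 hd ⊢
    have h1 := dist_of_turn hS hab hbc hca (w := π c) (by omega)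
    have h2 := dist_of_turn hS hab hbc hca (w := π a) (by omega)
    have h3 := hle c (π a) (hπ a)
    omega
  · intro v hv
    have hne : v ≠ π v := fun h => hv (h ▸ hπ v)
    obtain ⟨u, hu, hud⟩ := exists_next hS hne
    refine ⟨u, hu.symm, ?_⟩
    have h1 := hle u (π v) (hπ v)
    have h2 := hle v (π u) (hπ u)
    have t1 := hS.1.dist_triangle (u := v) (v := u) (w := π u)
    have t2 := SimpleGraph.dist_eq_one_iff_adj.2 hu
    simp only
    omega
  · intro v y hv hy hyK
    have h1 := (hzero v).2 hv
    have h2 := hle y v hv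
    have h3 := mt (hzero y).1 hyK
    have t2 := SimpleGraph.dist_eq_one_iff_adj.2 hy.symm
    simp only
    omega

/-- Far from the core, all edges at a vertex have their images on the same side of the edge
`pq`. -/
theorem exists_bound_bad (hT : T.IsTree) (hTact : ActsOn G T)
    {f : V → V → W} (hf : ∀ (g : G) (u v : V), S.Adj u v → f (g • u) (g • v) = g • f u v)
    (hSact : ActsOn G S) {F : Set V} (hF : F.Finite)
    (hcover : ∀ u v, S.Adj u v → ∃ g : G, u ∈ g • F ∧ v ∈ g • F)
    (hlink : ∀ v x y, S.Adj v x → S.Adj v y → Relation.ReflTransGen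
        (fun a b => S.Adj v a ∧ S.Adj v b ∧ ∃ g : G, v ∈ g • F ∧ a ∈ g • F ∧ b ∈ g • F) x y)
    {p q : W} (hpq : T.Adj p q) {d : V → ℕ}
    (hd : ∀ g ∈ edgeStabilizer G p q, ∀ v, d (g • v) = d v) :
    ∃ N, ∀ v, N ≤ d v → ∀ x y, S.Adj v x → S.Adj v y →
      (f v x ∈ halfTree T p q ↔ f v y ∈ halfTree T p q) ∧
      (f x v ∈ halfTree T p q ↔ f v y ∈ halfTree T p q) := by
  classical
  set Φ : Set W := (fun e : V × V => f e.1 e.2) '' F ×ˢ F with hΦ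
  have hΦfin : Φ.Finite := (hF.prod hF).image _
  set E : Set (W × W) := ⋃ φ ∈ Φ, ⋃ ψ ∈ Φ, segment T φ ψ ×ˢ segment T φ ψ with hE
  have hEfin : E.Finite := hΦfin.biUnion fun φ _ => hΦfin.biUnion fun ψ _ =>
    (segment_finite hT φ ψ).prod (segment_finite hT φ ψ)
  have hrep : ∀ e : W × W, ∃ c : G, (∃ g : G, g • e.1 = p ∧ g • e.2 = q) →
      c • e.1 = p ∧ c • e.2 = q := fun e => by
    by_cases h : ∃ g : G, g • e.1 = p ∧ g • e.2 = q
    · exact ⟨h.choose, fun _ => h.choose_spec⟩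
    · exact ⟨1, fun h' => absurd h' h⟩
  choose c hc using hrep
  obtain ⟨B, hB⟩ := ((hEfin.prod hF).image fun e : (W × W) × V => d (c e.1 • e.2)).bddAbove
  -- If `g • Φ` meets both sides of `pq`, then `g⁻¹` carries `(p, q)` into the finite set `E`. This
  -- leaves finitely many `g` modulo the stabilizer of `pq`, which preserves `d`, so `d` is bounded
  -- by `B` on such `g • F`.
  have good : ∀ v, B + 1 ≤ d v → ∀ g : G, v ∈ g • F → ∀ φ ∈ Φ, ∀ ψ ∈ Φ,
      g • φ ∈ halfTree T p q → g • ψ ∈ halfTree T p q := by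
    rintro v hv g ⟨w, hw, rfl⟩ φ hφ ψ hψ h1
    by_contra h2
    have hseg : IsConvex T (segment T (g • φ) (g • ψ)) := isConvex_segment hT _ _
    obtain ⟨hp, hq⟩ := hseg.edge_mem hT hpq (left_mem_segment _ _) (right_mem_segment _ _) h1 h2
    rw [← smul_inv_smul g p, smul_mem_segment hT hTact] at hp
    rw [← smul_inv_smul g q, smul_mem_segment hT hTact] at hq
    have hmem : (g⁻¹ • p, g⁻¹ • q) ∈ E :=
      Set.mem_iUnion₂.2 ⟨φ, hφ, Set.mem_iUnion₂.2 ⟨ψ, hψ, hp, hq⟩⟩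
    obtain ⟨c1, c2⟩ := hc (g⁻¹ • p, g⁻¹ • q) ⟨g, smul_inv_smul _ _, smul_inv_smul _ _⟩
    have hle : d (c (g⁻¹ • p, g⁻¹ • q) • w) ≤ B := hB ⟨((g⁻¹ • p, g⁻¹ • q), w), ⟨hmem, hw⟩, rfl⟩
    set k := c (g⁻¹ • p, g⁻¹ • q) with hk
    have hst : k * g⁻¹ ∈ edgeStabilizer G p q :=
      ⟨by change (k * g⁻¹) • p = p; rw [mul_smul]; exact c1,
        by change (k * g⁻¹) • q = q; rw [mul_smul]; exact c2⟩
    have := hd _ hst (g • w)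
    rw [mul_smul, inv_smul_smul] at this
    simp only at hv
    omega
  have same : ∀ v, B + 1 ≤ d v → ∀ g : G, v ∈ g • F → ∀ a b a' b', a ∈ g • F → b ∈ g • F →
      a' ∈ g • F → b' ∈ g • F → S.Adj a b → S.Adj a' b' →
      (f a b ∈ halfTree T p q ↔ f a' b' ∈ halfTree T p q) := by
    rintro v hv g hvg _ _ _ _ ⟨a, ha, rfl⟩ ⟨b, hb, rfl⟩ ⟨a', ha', rfl⟩ ⟨b', hb', rfl⟩ h1 h2
    simp only [adj_smul hSact] at h1 h2
    simp only [hf _ _ _ h1, hf _ _ _ h2]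
    exact ⟨good v hv g hvg _ ⟨(a, b), ⟨ha, hb⟩, rfl⟩ _ ⟨(a', b'), ⟨ha', hb'⟩, rfl⟩,
      good v hv g hvg _ ⟨(a', b'), ⟨ha', hb'⟩, rfl⟩ _ ⟨(a, b), ⟨ha, hb⟩, rfl⟩⟩
  refine ⟨B + 1, fun v hv x y hx hy => ?_⟩
  have h1 : f v x ∈ halfTree T p q ↔ f v y ∈ halfTree T p q := by
    have := hlink v x y hx hy
    clear hy
    induction this with
    | refl => exact Iff.rfl
    | tail _ hbc ih =>
      obtain ⟨hb, hc, g, hvg, hbg, hcg⟩ := hbc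
      exact ih.trans (same v hv g hvg _ _ _ _ hvg hbg hvg hcg hb hc)
  obtain ⟨g, hvg, hxg⟩ := hcover v x hx
  exact ⟨h1, (same v hv g hvg _ _ _ _ hxg hvg hvg hxg hx.symm hx).trans h1⟩

end Ingredients

end BassSerre

namespace BassSerre

/-! ### Colours of branches -/

section Colour

variable {V : Type*} (S : SimpleGraph V) (d : V → ℕ) (N : ℕ) (c : V → V → Prop)

/-- `b` is adjacent to `a` and farther from the core. -/
def IsChild (a b : V) : Prop :=
  S.Adj a b ∧ d b = d a + 1

/-- The descendants of a vertex. -/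
def IsDescendant : V → V → Prop :=
  Relation.ReflTransGen (IsChild S d)

/-- Some edge beyond `b`, at distance at least `N` from the core, has the colour `c`. -/
def HasColour (b : V) : Prop :=
  ∃ a a', IsDescendant S d b a ∧ IsChild S d a a' ∧ N ≤ d a ∧ c a a'

/-- All edges beyond `b`, at distance at least `N` from the core, have the same colour. -/
def IsMonochrome (b : V) : Prop :=
  ∀ a a', IsDescendant S d b a → IsChild S d a a' → N ≤ d a → (c a a' ↔ HasColour S d N c b)

variable {S d N c}

theorem IsDescendant.le {a b : V} (h : IsDescendant S d a b) : d a ≤ d b := by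
  induction h with
  | refl => exact le_rfl
  | tail _ h ih => have := h.2; omega

theorem isMonochrome_of_far
    (hgood : ∀ v, N ≤ d v → ∀ x y, S.Adj v x → S.Adj v y → (c v x ↔ c v y) ∧ (c x v ↔ c v y))
    {v : V} (hv : N ≤ d v) : IsMonochrome S d N c v := by
  -- The colour propagates outward: an edge entering a far vertex and the edges leaving it agree,
  -- although `c` may depend on orientation.
  have claim : ∀ a, IsDescendant S d v a → ∀ a', IsChild S d a a' → ∀ b, IsChild S d v b →
      (c a a' ↔ c v b) := by
    intro a ha
    induction ha with
    | refl => exact fun a' ha' b hb => (hgood v hv a' b ha'.1 hb.1).1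
    | @tail a₁ a h₁ h₂ ih =>
      intro a' ha' b hb
      have hle := IsDescendant.le (h₁.tail h₂)
      rw [← ih a h₂ b hb]
      exact (hgood a (by omega) a₁ a' h₂.1.symm ha'.1).2.symm
  intro a a' ha ha' hN
  obtain ⟨b, hb⟩ : ∃ b, IsChild S d v b := by
    rcases Relation.ReflTransGen.cases_head ha with rfl | ⟨b, hb, -⟩
    · exact ⟨a', ha'⟩
    · exact ⟨b, hb⟩
  rw [claim a ha a' ha' b hb]
  constructor
  · exact fun h => ⟨v, b, Relation.ReflTransGen.refl, hb, hv, h⟩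
  · rintro ⟨a₁, a₁', h1, h2, -, h4⟩
    exact (claim a₁ h1 a₁' h2 b hb).1 h4

/-- Backward induction from distance `N`: if the child branches at `v` are monochrome and `hlink`
equates their colours, the whole branch at `v` is monochrome. -/
theorem isMonochrome_of_pos
    (hgood : ∀ v, N ≤ d v → ∀ x y, S.Adj v x → S.Adj v y → (c v x ↔ c v y) ∧ (c x v ↔ c v y))
    (hlink : ∀ v, 1 ≤ d v → (∀ b, IsChild S d v b → IsMonochrome S d N c b) →
      ∀ b b', IsChild S d v b → IsChild S d v b' →
      (HasColour S d N c b ↔ HasColour S d N c b'))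
    (v : V) (hv : 1 ≤ d v) : IsMonochrome S d N c v := by
  suffices ∀ n v, 1 ≤ d v → N ≤ d v + n → IsMonochrome S d N c v from
    this N v hv (by omega)
  intro n
  induction n with
  | zero => exact fun v _ h => isMonochrome_of_far hgood h
  | succ n ih =>
    intro v hv hn
    by_cases hN : N ≤ d v
    · exact isMonochrome_of_far hgood hN
    have hch : ∀ b, IsChild S d v b → IsMonochrome S d N c b := fun b hb =>
      ih b (by have := hb.2; omega) (by have := hb.2; omega)
    have key : ∀ a, IsDescendant S d v a → N ≤ d a → ∃ b, IsChild S d v b ∧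
        IsDescendant S d b a := by
      intro a ha hNa
      rcases Relation.ReflTransGen.cases_head ha with rfl | h
      · exact absurd hNa hN
      · exact h
    intro a a' ha ha' hNa
    obtain ⟨b, hb, hba⟩ := key a ha hNa
    rw [hch b hb a a' hba ha' hNa]
    constructor
    · rintro ⟨x, x', h1, h2⟩
      exact ⟨x, x', h1.head hb, h2⟩
    · rintro ⟨x, x', h1, h2, h3, h4⟩
      obtain ⟨b', hb', hbx⟩ := key x h1 h3
      exact (hlink v hv hch b b' hb hb').2 ⟨x, x', hbx, h2, h3, h4⟩

theorem exists_root {K : Set V} (hzero : ∀ v, d v = 0 ↔ v ∈ K)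
    (hparent : ∀ v, v ∉ K → ∃ u, S.Adj u v ∧ d v = d u + 1) (v : V) (hv : 1 ≤ d v) :
    ∃ w ∈ K, ∃ y, IsChild S d w y ∧ IsDescendant S d y v := by
  induction hn : d v generalizing v with
  | zero => omega
  | succ n ih =>
    obtain ⟨u, hu, hd⟩ := hparent v fun h => by have := (hzero v).2 h; omega
    by_cases h0 : d u = 0
    · exact ⟨u, (hzero u).1 h0, v, ⟨hu, hd⟩, Relation.ReflTransGen.refl⟩
    · obtain ⟨w, hw, y, hy, hyu⟩ := ih u (by omega) (by omega)
      exact ⟨w, hw, y, hy, hyu.tail ⟨hu, hd⟩⟩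

end Colour

/-! ### The main argument: comparing colours along axes -/

section Main

variable {G : Type*} [Group G] {V : Type*} [MulAction G V] {S : SimpleGraph V}
variable {W : Type*} [MulAction G W] {T : SimpleGraph W}

/-- The colour of a branch crossed by a line translated by an elliptic element is the side of the
fixed point. -/
theorem hasColour_of_line (hT : T.IsTree) (hTact : ActsOn G T) {p q : W} (hpq : T.Adj p q)
    {f : V → V → W} (hf : ∀ (g : G) (u v : V), S.Adj u v → f (g • u) (g • v) = g • f u v)
    {d : V → ℕ} {N : ℕ}
    (hturn : ∀ a b c, S.Adj a b → S.Adj b c → c ≠ a → d b = d a + 1 → d c = d b + 1)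
    {t : G} {L : ℤ → V} {k : ℤ} (hL : IsLine S L) (htL : ∀ n, t • L n = L (n + k)) (hk : k ≠ 0)
    {p₀ : W} (hp₀ : t • p₀ = p₀)
    (hpow : ∀ n : ℤ, n ≠ 0 → ¬ (t ^ n • p = p ∧ t ^ n • q = q)) {v b : V}
    (hv : v ∈ Set.range L) (hb : b ∈ Set.range L) (hvb : IsChild S d v b)
    (hmono : IsMonochrome S d N (fun a a' => f a a' ∈ halfTree T p q) b) :
    HasColour S d N (fun a a' => f a a' ∈ halfTree T p q) b ↔ p₀ ∈ halfTree T p q := by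
  have key : ∀ {L : ℤ → V} {k : ℤ} {i : ℤ}, IsLine S L → (∀ n, t • L n = L (n + k)) → k ≠ 0 →
      L i = v → L (i + 1) = b →
      (HasColour S d N (fun a a' => f a a' ∈ halfTree T p q) b ↔ p₀ ∈ halfTree T p q) := by
    rintro L k i hL htL hk rfl rfl
    have hchild : ∀ m : ℕ, IsChild S d (L (i + m)) (L (i + m + 1)) := by
      intro m
      induction m with
      | zero => simpa using hvb
      | succ m ih =>
        have e : i + ((m + 1 : ℕ) : ℤ) = i + m + 1 := by push_cast; ring
        rw [e]
        refine ⟨hL.adj _, hturn _ _ _ ih.1 (hL.adj _) (fun e => ?_) ih.2⟩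
        have := hL.injective e
        omega
    have hdesc : ∀ m : ℕ, IsDescendant S d (L (i + 1)) (L (i + m + 1)) ∧
        m ≤ d (L (i + m + 1)) := by
      intro m
      induction m with
      | zero => exact ⟨by rw [Nat.cast_zero, add_zero]; exact Relation.ReflTransGen.refl, by omega⟩
      | succ m ih =>
        have e : i + ((m + 1 : ℕ) : ℤ) = i + m + 1 := by push_cast; ring
        have hc := hchild (m + 1)
        rw [e] at hc
        rw [e]
        exact ⟨ih.1.tail hc, by have := hc.2; omega⟩
    -- A power of `t` pushes the edge out through `b`, beyond distance `N` from the core, with its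
    -- image on the side of `p₀`. The bound `N + 1` accounts for the ray starting one step before
    -- `b`.
    obtain ⟨j, hj, hside⟩ := exists_large_power hT hTact hpq hp₀ hpow (f (L i) (L (i + 1))) hk
      (N + 1)
    obtain ⟨m, hm⟩ : ∃ m : ℕ, j * k = m + 1 := ⟨(j * k - 1).toNat, by omega⟩
    rw [← hside, ← hf _ _ _ (hL.adj i), zpow_smul_line htL, zpow_smul_line htL, hm]
    have e1 : i + ((m : ℤ) + 1) = i + m + 1 := by ring
    have e2 : i + 1 + ((m : ℤ) + 1) = i + m + 1 + 1 := by ring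
    rw [e1, e2]
    have hc := hchild (m + 1)
    have e : i + ((m + 1 : ℕ) : ℤ) = i + m + 1 := by push_cast; ring
    rw [e] at hc
    exact (hmono _ _ (hdesc m).1 hc ((by omega : N ≤ m).trans (hdesc m).2)).symm
  obtain ⟨i, rfl⟩ := hv
  obtain ⟨j, rfl⟩ := hb
  rcases (hL.adj_iff _ _).1 hvb.1 with rfl | rfl
  · exact key hL htL hk rfl rfl
  · refine key (i := -i) hL.neg (neg_line htL) (neg_ne_zero.2 hk) ?_ ?_
    · rw [neg_neg]
    · congr 1; ring

/-- The segments of the test family lie on lines translated by conjugates of `h`. -/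
theorem exists_line_of_test (hS : S.IsTree) (hact : ActsOn G S) {P : Set (V × V)} {h : G}
    (htest : ∀ q ∈ P, ∃ g : G, g • segment S q.1 q.2 ⊆ axis S h) {x y : V}
    (hxy : orbitRel (⊤ : Subgroup G) P x y) :
    ∃ (b : G) (L : ℤ → V) (k : ℤ), IsLine S L ∧ (∀ n, (b * h * b⁻¹) • L n = L (n + k)) ∧ k ≠ 0 ∧
      segment S x y ⊆ Set.range L := by
  have hsymm : ∀ a b : V, segment S a b = segment S b a := fun a b => by
    ext z
    simp only [segment, Set.mem_ofPred_eq]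
    rw [S.dist_comm (u := a) (v := b), S.dist_comm (u := a) (v := z),
      S.dist_comm (u := z) (v := b), add_comm]
  obtain ⟨a, q, hq, hseg⟩ : ∃ a : G, ∃ q ∈ P, segment S x y = segment S (a • q.1) (a • q.2) := by
    obtain ⟨a, -, q, hq, ⟨rfl, rfl⟩ | ⟨rfl, rfl⟩⟩ := hxy
    · exact ⟨a, q, hq, rfl⟩
    · exact ⟨a, q, hq, hsymm _ _⟩
  obtain ⟨g, hg⟩ := htest q hq
  obtain ⟨f, hinj, hadj, ⟨k, hk, hfk⟩, -⟩ :=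
    hg (Set.smul_mem_smul_set (left_mem_segment (T := S) q.1 q.2))
  have hf := isLine_of_injective hS hinj hadj
  refine ⟨a * g⁻¹, fun n => (a * g⁻¹) • f n, k, hf.smul hS hact _, conj_line hfk _, hk, ?_⟩
  intro z hz
  rw [hseg, ← smul_inv_smul a z, smul_mem_segment hS hact] at hz
  obtain ⟨f', hinj', hadj', ⟨k', hk', hfk'⟩, hz'⟩ := hg (Set.smul_mem_smul_set hz)
  rw [range_line_unique hS hact (isLine_of_injective hS hinj' hadj') hfk' hk' hf hfk hk] at hz'
  obtain ⟨n, hn⟩ := hz'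
  refine ⟨n, ?_⟩
  simp only [hn, mul_smul, inv_smul_smul, smul_inv_smul]

/-- Extending `[w₁, w₂]` outward at both ends gives a geodesic, so an axis containing `[y₁, y₂]`
crosses both branches. -/
theorem dist_away (hS : S.IsTree) {w₁ w₂ y₁ y₂ : V} (hne : w₁ ≠ w₂) (h₁ : S.Adj w₁ y₁)
    (h₂ : S.Adj w₂ y₂) (d₁ : S.dist y₁ w₂ = S.dist w₁ w₂ + 1)
    (d₂ : S.dist y₂ w₁ = S.dist w₂ w₁ + 1) :
    w₁ ∈ segment S y₁ y₂ ∧ w₂ ∈ segment S y₁ y₂ := by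
  have e : S.dist y₁ y₂ = S.dist w₁ w₂ + 2 := by
    rcases dist_adj_cases hS y₁ h₂ with h | h
    · exfalso
      obtain ⟨z, hz, hzd⟩ := exists_next hS hne.symm
      have t := hS.1.dist_triangle (u := z) (v := w₁) (w := y₁)
      have t1 := SimpleGraph.dist_eq_one_iff_adj.2 h₁
      rw [S.dist_comm (u := y₁), S.dist_comm (u := w₁)] at d₁
      have : S.dist z y₁ + 1 = S.dist w₂ y₁ := by
        rcases dist_adj_cases hS y₁ hz with h' | h'
        · exact h'
        · omega
      have := next_unique hS h₂ hz h this
      subst this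
      omega
    · rw [S.dist_comm, h, S.dist_comm, d₁]
  have t1 := SimpleGraph.dist_eq_one_iff_adj.2 h₁.symm
  have t2 := SimpleGraph.dist_eq_one_iff_adj.2 h₂
  rw [S.dist_comm (u := y₂), S.dist_comm (u := w₂)] at d₂
  simp only [segment, Set.mem_ofPred_eq]
  omega

/-- The main argument, for trees that are not lines. -/
theorem IsGTree.not_elliptic_of_test (hG : Group.FG G) (hS : IsGTree G S) [Nontrivial V]
    (hS' : ∀ u v, S.Adj u v → IsBranch S u ∨ IsBranch S v) (hbr : ∃ v, IsBranch S v)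
    {P : Set (V × V)}
    (hPlink : ∀ (v : V) (Z : Finset V), Z.card ≤ 2 → ∀ x y, S.Adj v x → S.Adj v y → x ∉ Z →
      y ∉ Z → Relation.ReflTransGen (fun a b => S.Adj v a ∧ S.Adj v b ∧ a ∉ Z ∧ b ∉ Z ∧
          orbitRel (⊤ : Subgroup G) P a b) x y)
    (hPnext : ∀ w₁ w₂, IsBranch S w₁ → IsBranch S w₂ →
        (S.Adj w₁ w₂ ∨ w₁ ≠ w₂ ∧ ∃ u, ¬ IsBranch S u ∧ S.Adj u w₁ ∧ S.Adj u w₂) →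
        ∀ x₁ x₂, ∃ y₁ y₂, orbitRel (⊤ : Subgroup G) P y₁ y₂ ∧ y₁ ≠ x₁ ∧ y₂ ≠ x₂ ∧
          S.Adj w₁ y₁ ∧ S.Adj w₂ y₂ ∧ S.dist y₁ w₂ = S.dist w₁ w₂ + 1 ∧
          S.dist y₂ w₁ = S.dist w₂ w₁ + 1)
    {h : G} (htest : ∀ q ∈ P, ∃ g : G, g • segment S q.1 q.2 ⊆ axis S h)
    (hT : IsGTree G T) [Nontrivial W] (hT' : IsSlenderTree G T)
    (hell : IsEllipticWithRespectTo G S W) : IsHyperbolic h W := by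
  classical
  rintro ⟨p₀, hp₀⟩
  have hSt := hS.isTree
  have hTt := hT.isTree
  obtain ⟨p, q, hpq⟩ : ∃ p q, T.Adj p q := ⟨p₀, hT.exists_adj p₀⟩
  obtain ⟨f, hf⟩ := exists_equivariant (W := W) hS.smul_adj hell
  set A := edgeStabilizer G p q with hA
  obtain ⟨K, hKne, hK, hKA, hKtype⟩ := exists_core hSt hS.smul_adj hS.no_inversion
    (A := A) fun B hB => (hT' p q hpq).fg_of_le hB
  obtain ⟨d, hzero, hdinv, hturn, hparent, hout⟩ := exists_coreDist hSt hS.smul_adj hK hKne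
  obtain ⟨F, hF, -, hcover, hlinkF⟩ := hS.exists_fundamental_set hG
  obtain ⟨N, hN⟩ := exists_bound_bad hTt hT.smul_adj hf hS.smul_adj hF hcover hlinkF hpq
    (d := d) fun g hg v => hdinv g (hKA g hg) (hKA g⁻¹ (A.inv_mem hg)) v
  set col : V → Prop := HasColour S d N fun a a' => f a a' ∈ halfTree T p q with hcol
  set mono : V → Prop := IsMonochrome S d N fun a a' => f a a' ∈ halfTree T p q with hmono
  have hchildK : ∀ {v b}, IsChild S d v b → b ∉ K := fun hvb hb => by
    have := (hzero _).2 hb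
    have := hvb.2
    omega
  -- two branches crossed by a translate of the same test segment have the same colour
  have linked : ∀ {y₁ y₂ v₁ v₂}, orbitRel (⊤ : Subgroup G) P y₁ y₂ → v₁ ∈ segment S y₁ y₂ →
      v₂ ∈ segment S y₁ y₂ → IsChild S d v₁ y₁ → IsChild S d v₂ y₂ → mono y₁ → mono y₂ →
      (col y₁ ↔ col y₂) := by
    intro y₁ y₂ v₁ v₂ hrel hv₁ hv₂ hc₁ hc₂ hm₁ hm₂
    obtain ⟨b, L, k, hL, htL, hk, hseg⟩ := exists_line_of_test hSt hS.smul_adj htest hrel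
    have hfix : (b * h * b⁻¹) • (b • p₀) = b • p₀ := by
      rw [mul_smul, inv_smul_smul, mul_smul, hp₀]
    -- A non-trivial power in `A` would preserve `K`, forcing its axis into `K`; but the axis
    -- contains `y₁`, which is outside.
    have hpow : ∀ n : ℤ, n ≠ 0 → ¬ ((b * h * b⁻¹) ^ n • p = p ∧ (b * h * b⁻¹) ^ n • q = q) := by
      intro n hn hpqn
      have hmem : (b * h * b⁻¹) ^ n ∈ A := hpqn
      have hsub := line_subset_of_invariant hSt hS.smul_adj hL (zpow_smul_line htL n)
        (mul_ne_zero hn hk) hK hKne fun j x hx => hKA _ (A.zpow_mem hmem j) x hx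
      exact hchildK hc₁ (hsub (hseg (left_mem_segment _ _)))
    rw [hcol, hasColour_of_line hTt hT.smul_adj hpq hf hturn hL htL hk hfix hpow (hseg hv₁)
      (hseg (left_mem_segment _ _)) hc₁ hm₁, hasColour_of_line hTt hT.smul_adj hpq hf hturn hL htL
      hk hfix hpow (hseg hv₂) (hseg (right_mem_segment _ _)) hc₂ hm₂]
  have linkedAt : ∀ (v : V) (Z : Finset V), Z.card ≤ 2 →
      (∀ x, S.Adj v x → x ∉ Z → IsChild S d v x ∧ mono x) →
      ∀ x y, S.Adj v x → S.Adj v y → x ∉ Z → y ∉ Z → (col x ↔ col y) := by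
    intro v Z hZ hch x y hx hy hxZ hyZ
    have := hPlink v Z hZ x y hx hy hxZ hyZ
    clear hy hyZ
    induction this with
    | refl => exact Iff.rfl
    | @tail a b _ hab ih =>
      obtain ⟨ha, hb, haZ, hbZ, hrel⟩ := hab
      refine ih.trans ?_
      by_cases e : b = a
      · rw [e]
      have h2 : v ∈ segment S a b := by
        simp only [segment, Set.mem_ofPred_eq]
        rw [dist_two hSt ha.symm hb e, SimpleGraph.dist_eq_one_iff_adj.2 ha.symm,
          SimpleGraph.dist_eq_one_iff_adj.2 hb]
      exact linked hrel h2 h2 (hch a ha haZ).1 (hch b hb hbZ).1 (hch a ha haZ).2 (hch b hb hbZ).2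
  have hmonoAll : ∀ v, 1 ≤ d v → mono v := by
    refine isMonochrome_of_pos (fun v hv => hN v hv) ?_
    intro v hv hch b b' hb hb'
    obtain ⟨u, hu, hud⟩ := hparent v fun hvK => by have := (hzero v).2 hvK; omega
    have hne : ∀ {x}, IsChild S d v x → x ∉ ({u} : Finset V) := by
      intro x hx e
      rw [Finset.mem_singleton] at e
      have := hx.2
      rw [e] at this
      omega
    -- Outside the core only the parent `u` has to be removed from the link.
    refine linkedAt v {u} (by simp) (fun x hx hxu => ?_) b b' hb.1 hb'.1 (hne hb) (hne hb')
    have hc : IsChild S d v x :=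
      ⟨hx, hturn u v x hu hx (by simpa using hxu) hud⟩
    exact ⟨hc, hch x hc⟩
  have hmonoChild : ∀ {w y}, IsChild S d w y → mono y := fun hy =>
    hmonoAll _ (by have := hy.2; omega)
  -- the neighbours in the core
  have hZ : ∀ w ∈ K, ∃ Z : Finset V, Z.card ≤ 2 ∧ ∀ x, S.Adj w x → (x ∈ Z ↔ x ∈ K) := by
    intro w hw
    rcases hKtype with ⟨v, rfl⟩ | ⟨L, hL, rfl⟩
    · obtain rfl : w = v := hw
      refine ⟨∅, by simp, fun x hx => ?_⟩
      simp [hx.ne']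
    · obtain ⟨n, rfl⟩ := hw
      refine ⟨{L (n + 1), L (n - 1)}, Finset.card_le_two, fun x hx => ?_⟩
      simp only [Finset.mem_insert, Finset.mem_singleton]
      constructor
      · rintro (rfl | rfl) <;> exact ⟨_, rfl⟩
      · rintro ⟨m, rfl⟩
        rcases (hL.adj_iff _ _).1 hx with rfl | rfl
        · exact Or.inl rfl
        · exact Or.inr rfl
  have hchild : ∀ {w y}, w ∈ K → S.Adj w y → y ∉ K → IsChild S d w y := fun hw hy hyK =>
    ⟨hy, hout _ _ hw hy hyK⟩
  have hsame : ∀ w ∈ K, ∀ y y', IsChild S d w y → IsChild S d w y' → (col y ↔ col y') := by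
    intro w hw y y' hy hy'
    obtain ⟨Z, hZc, hZK⟩ := hZ w hw
    refine linkedAt w Z hZc (fun x hx hxZ => ?_) y y' hy.1 hy'.1
      (fun e => hchildK hy ((hZK y hy.1).1 e)) (fun e => hchildK hy' ((hZK y' hy'.1).1 e))
    have hc := hchild hw hx fun e => hxZ ((hZK x hx).2 e)
    exact ⟨hc, hmonoChild hc⟩
  have hhang : ∀ w ∈ K, ∀ w' ∈ K, ∀ y y', IsChild S d w y → IsChild S d w' y' →
      (col y ↔ col y') := by
    rcases hKtype with ⟨v, rfl⟩ | ⟨L, hL, rfl⟩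
    · intro w hw w' hw'
      obtain rfl : w = w' := hw.trans hw'.symm
      exact hsame w hw
    have hbranch : ∀ {i y}, IsChild S d (L i) y → IsBranch S (L i) := by
      intro i y hy
      refine ⟨L (i + 1), L (i - 1), y, hL.adj i, (hL.adj_iff _ _).2 (Or.inr rfl), hy.1,
        fun e => ?_, fun e => hchildK hy ⟨_, e⟩, fun e => hchildK hy ⟨_, e⟩⟩
      have := hL.injective e
      omega
    -- one step along the line
    have step : ∀ (i e s : ℤ), e ≠ 0 → (s = 1 ∨ s = -1) → (0 < e * s) →
        IsBranch S (L i) → IsBranch S (L (i + e)) →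
        (S.Adj (L i) (L (i + e)) ∨ L i ≠ L (i + e) ∧
          ∃ u, ¬ IsBranch S u ∧ S.Adj u (L i) ∧ S.Adj u (L (i + e))) →
        ∃ y₁ y₂, IsChild S d (L i) y₁ ∧ IsChild S d (L (i + e)) y₂ ∧ (col y₁ ↔ col y₂) := by
      intro i e s he hs hes hb₁ hb₂ hrel
      obtain ⟨y₁, y₂, hr, n₁, n₂, a₁, a₂, d₁, d₂⟩ := hPnext _ _ hb₁ hb₂ hrel (L (i - s))
        (L (i + e + s))
      have hy₁ : y₁ ∉ Set.range L := by
        rintro ⟨m, rfl⟩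
        have hm := (hL.adj_iff _ _).1 a₁
        have hm' : m ≠ i - s := fun e => n₁ (by rw [e])
        rw [hL, hL] at d₁
        rcases hs with rfl | rfl <;> omega
      have hy₂ : y₂ ∉ Set.range L := by
        rintro ⟨m, rfl⟩
        have hm := (hL.adj_iff _ _).1 a₂
        have hm' : m ≠ i + e + s := fun e => n₂ (by rw [e])
        rw [hL, hL] at d₂
        rcases hs with rfl | rfl <;> omega
      have hc₁ := hchild ⟨i, rfl⟩ a₁ hy₁
      have hc₂ := hchild ⟨i + e, rfl⟩ a₂ hy₂
      have hne : L i ≠ L (i + e) := fun e' => by have := hL.injective e'; omega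
      obtain ⟨m₁, m₂⟩ := dist_away hSt hne a₁ a₂ d₁ d₂
      exact ⟨y₁, y₂, hc₁, hc₂, linked hr m₁ m₂ hc₁ hc₂ (hmonoChild hc₁) (hmonoChild hc₂)⟩
    have main : ∀ n : ℕ, ∀ i i' : ℤ, (i' - i).natAbs = n → ∀ y y', IsChild S d (L i) y →
        IsChild S d (L i') y' → (col y ↔ col y') := by
      intro n
      -- Advance along `K` from one branch vertex to the next, by 1 or by 2, since two adjacent
      -- vertices cannot both have valence 2.
      induction n using Nat.strong_induction_on with
      | _ n ih =>
        intro i i' hn y y' hy hy'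
        by_cases hii : i = i'
        · subst hii
          exact hsame _ ⟨i, rfl⟩ y y' hy hy'
        obtain ⟨s, hs, hsd⟩ : ∃ s : ℤ, (s = 1 ∨ s = -1) ∧
            (i' - (i + s)).natAbs + 1 = (i' - i).natAbs := by
          rcases lt_or_gt_of_ne hii with h | h
          · exact ⟨1, Or.inl rfl, by omega⟩
          · exact ⟨-1, Or.inr rfl, by omega⟩
        have hadj : ∀ j, S.Adj (L j) (L (j + s)) := fun j => by
          rw [hL.adj_iff]; omega
        by_cases hb : IsBranch S (L (i + s))
        · obtain ⟨y₁, y₂, h1, h2, h3⟩ := step i s s (by omega) hs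
            (by rcases hs with rfl | rfl <;> norm_num) (hbranch hy) hb (Or.inl (hadj i))
          exact (hsame _ ⟨i, rfl⟩ y y₁ hy h1).trans (h3.trans
            (ih _ (by omega) (i + s) i' rfl y₂ y' h2 hy'))
        · have hne : i + s ≠ i' := fun e => hb (e ▸ hbranch hy')
          have hb2 : IsBranch S (L (i + 2 * s)) := by
            have := hadj (i + s)
            rw [show i + s + s = i + 2 * s by ring] at this
            exact (hS' _ _ this).resolve_left hb
          obtain ⟨y₁, y₂, h1, h2, h3⟩ := step i (2 * s) s (by omega) hs
            (by rcases hs with rfl | rfl <;> norm_num) (hbranch hy) hb2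
            (Or.inr ⟨fun e => by have := hL.injective e; omega, L (i + s), hb, (hadj i).symm, by
              have := hadj (i + s)
              rwa [show i + s + s = i + 2 * s by ring] at this⟩)
          exact (hsame _ ⟨i, rfl⟩ y y₁ hy h1).trans (h3.trans
            (ih _ (by omega) (i + 2 * s) i' rfl y₂ y' h2 hy'))
    rintro _ ⟨i, rfl⟩ _ ⟨i', rfl⟩
    exact main _ i i' rfl
  -- all edges far from the core have the same colour
  have hall : ∀ a a' b b', IsChild S d a a' → IsChild S d b b' → 1 ≤ d a → 1 ≤ d b → N ≤ d a →
      N ≤ d b → f a a' ∈ halfTree T p q → f b b' ∈ halfTree T p q := by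
    intro a a' b b' ha hb h1a h1b hNa hNb hfa
    obtain ⟨w, hw, y, hy, hya⟩ := exists_root hzero hparent a h1a
    obtain ⟨w', hw', y', hy', hyb⟩ := exists_root hzero hparent b h1b
    have e1 := hmonoChild hy a a' hya ha hNa
    have e2 := hmonoChild hy' b b' hyb hb hNb
    exact e2.2 ((hhang w hw w' hw' y y' hy hy').1 (e1.1 hfa))
  -- every translate of a large tripod has an edge far from the core
  obtain ⟨c, n₁, n₂, n₃, hn₁, hn₂, hn₃, h12, h13, h23⟩ := hbr
  choose r r0 r1 hradj hrne using fun n : {n // S.Adj c n} =>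
    exists_ray (fun u v => hS.exists_adj_ne) n.2
  have hray : ∀ (g : G) (n : {n // S.Adj c n}), IsChild S d (g • c) (g • n.1) →
      ∀ m, IsChild S d (g • r n m) (g • r n (m + 1)) ∧ m ≤ d (g • r n m) := by
    intro g n hc m
    induction m with
    | zero => rw [r0, zero_add, r1]; exact ⟨hc, Nat.zero_le _⟩
    | succ m ih =>
      refine ⟨⟨hS.smul_adj g _ _ (hradj n (m + 1)), hturn _ _ _ ih.1.1
        (hS.smul_adj g _ _ (hradj n (m + 1))) (fun e => hrne n m (MulAction.injective g e))
        ih.1.2⟩, ?_⟩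
      have := ih.1.2
      omega
  -- At most two neighbours of `g • c` lie in `K`, or exactly one leads back towards it, so one of
  -- three legs goes outward.
  have hleg : ∀ g : G, ∃ n : {n // S.Adj c n}, n.1 ∈ ({n₁, n₂, n₃} : Set V) ∧
      IsChild S d (g • c) (g • n.1) := by
    intro g
    have hinj : ∀ {x y : V}, x ≠ y → g • x ≠ g • y := fun h e => h (MulAction.injective g e)
    by_cases hgc : g • c ∈ K
    · obtain ⟨Z, hZc, hZK⟩ := hZ _ hgc
      by_contra hcon
      push Not at hcon
      have hin : ∀ n, S.Adj c n → n ∈ ({n₁, n₂, n₃} : Set V) → g • n ∈ Z := by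
        intro n hn hmem
        by_contra hnZ
        have hadj := hS.smul_adj g _ _ hn
        exact hcon ⟨n, hn⟩ hmem (hchild hgc hadj fun e => hnZ ((hZK _ hadj).2 e))
      have hsub : ({g • n₁, g • n₂, g • n₃} : Finset V) ⊆ Z := by
        intro x hx
        simp only [Finset.mem_insert, Finset.mem_singleton] at hx
        rcases hx with rfl | rfl | rfl
        · exact hin _ hn₁ (by simp)
        · exact hin _ hn₂ (by simp)
        · exact hin _ hn₃ (by simp)
      have h3 := Finset.card_le_card hsub
      rw [Finset.card_eq_three.2 ⟨_, _, _, hinj h12, hinj h13, hinj h23, rfl⟩] at h3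
      omega
    · obtain ⟨u, hu, hud⟩ := hparent _ hgc
      have hc : ∀ n, S.Adj c n → g • n ≠ u → IsChild S d (g • c) (g • n) := fun n hn hne =>
        ⟨hS.smul_adj g _ _ hn, hturn u _ _ hu (hS.smul_adj g _ _ hn) hne hud⟩
      by_cases e : g • n₁ = u
      · exact ⟨⟨n₂, hn₂⟩, by simp, hc n₂ hn₂ fun e' => hinj h12 (e.trans e'.symm)⟩
      · exact ⟨⟨n₁, hn₁⟩, by simp, hc n₁ hn₁ e⟩
  -- Edges starting `N + 1` steps out on the legs: wherever the tripod is moved, the one on an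
  -- outward leg starts at distance at least `N + 1` from `K`.
  set Φ : Set W := (fun n : {n // S.Adj c n} => f (r n (N + 1)) (r n (N + 1 + 1))) ''
    {n | n.1 ∈ ({n₁, n₂, n₃} : Set V)} with hΦ
  have hΦfin : Φ.Finite := by
    refine Set.Finite.image _ (Set.Finite.of_finite_image
      ((Set.toFinite {n₁, n₂, n₃}).subset ?_) Subtype.val_injective.injOn)
    rintro _ ⟨n, hn, rfl⟩
    exact hn
  obtain ⟨g, hg⟩ := hT.exists_smul_subset_halfTree hpq hΦfin
  obtain ⟨g', hg'⟩ := hT.exists_smul_subset_halfTree hpq.symm hΦfin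
  obtain ⟨n, hn, hnc⟩ := hleg g
  obtain ⟨n', hn', hnc'⟩ := hleg g'
  have a1 := hray g n hnc (N + 1)
  have a2 := hray g' n' hnc' (N + 1)
  have b1 := hg _ ⟨n, hn, rfl⟩
  have b2 := hg' _ ⟨n', hn', rfl⟩
  rw [← hf _ _ _ (hradj n _)] at b1
  rw [← hf _ _ _ (hradj n' _), mem_halfTree_symm hTt hpq] at b2
  exact b2 (hall _ _ _ _ a1.1 a2.1 (by omega) (by omega) (by omega) (by omega) b1)

end Main

end BassSerre

/-! ### The theorem: points, lines and branching trees -/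

theorem mainTheorem6 {G : Type u} [Group G] (hG : Group.FG G)
    {V : Type v} [MulAction G V] (S : SimpleGraph V) (hS : BassSerre.IsGTree G S)
    (hS' : BassSerre.IsLocallyFinite S ∨ BassSerre.IsSlenderTree G S) :
    ∃ I : Set (Set V), I.Finite ∧
      (∀ J ∈ I, ∃ x y : V, S.dist x y ≤ 4 ∧ J = BassSerre.segment S x y) ∧
      ∀ h : G, BassSerre.IsHyperbolic h V →
        (∀ J ∈ I, ∃ g : G, g • J ⊆ BassSerre.axis S h) →
        ∀ (W : Type w) [MulAction G W] (T : SimpleGraph W),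
          BassSerre.IsGTree G T → Nontrivial W → BassSerre.IsSlenderTree G T →
          BassSerre.IsEllipticWithRespectTo G S W →
          BassSerre.IsHyperbolic h W := by
  rcases subsingleton_or_nontrivial V with hV | hV
  -- On a point every element is elliptic, so there is nothing to test.
  · refine ⟨∅, Set.finite_empty, by simp, fun h hh => ?_⟩
    exact absurd ⟨hS.isTree.1.nonempty.some, Subsingleton.elim _ _⟩ hh
  by_cases hline : ∀ v, ¬ BassSerre.IsBranch S v
  · refine ⟨∅, Set.finite_empty, by simp, ?_⟩
    intro h hh _ W _ T hT hW _ hell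
    exact hS.not_elliptic_of_line hline hT hell hh
  · push Not at hline
    obtain ⟨v, hv⟩ := hline
    obtain ⟨P, hPfin, hPlen, hPlink, hPnext⟩ := hS.exists_test_pairs hG hS'
    refine ⟨(fun q : V × V => BassSerre.segment S q.1 q.2) '' P, hPfin.image _, ?_, ?_⟩
    · rintro _ ⟨q, hq, rfl⟩
      exact ⟨q.1, q.2, hPlen q hq, rfl⟩
    · intro h _ htest W _ T hT hW hT' hell
      refine hS.not_elliptic_of_test hG (fun x y hxy => ?_) ⟨v, hv⟩ hPlink hPnext
        (fun q hq => htest _ ⟨q, hq, rfl⟩) hT hT' hell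
      by_contra hc
      push Not at hc
      exact hS.not_isBranch_of_adj hxy hc.1 hc.2 v hv
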